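/- \textbf{Setting.} Let $\mathbb{T}\in\{\mathbb{Z},\mathbb{Z}_+,\mathbb{R},\mathbb{R}_+\}$ and $\mathbb{T}_+=\mathbb{T}\cap[0,\infty)$; below, $t\to+\infty$ means $t\in\mathbb{T}_+$, $t\to+\infty$. Let $\mathcal{Q}$ and $\Omega$ be complete metric spaces. For each $\omega\in\Omega$ let $\vartheta_\omega=\{\vartheta_\omega^t\}_{t\in\mathbb{T}}$ be a dynamical system on $\mathcal{Q}$, i.e. $\vartheta_\omega^{t+s}=\vartheta_\omega^t\circ\vartheta_\omega^s$, $\vartheta_\omega^0=\mathrm{id}$ and $(t,q)\mapsto\vartheta_\omega^t(q)$ is continuous. Suppose that for every $\omega$ it has a $2^{\mathcal{Q}}$-attractor $\mathcal{A}_\omega$, i.e. a minimal (by inclusion) set among the compact sets $\mathcal{A}\subset\mathcal{Q}$ with $\sup_{q\in\mathcal{Q}}\operatorname{dist}(\vartheta_\omega^t(q),\mathcal{A})\to0$ as $t\to+\infty$. Let $\mathcal{B}_0\subset\mathcal{Q}$ contain $\mathcal{A}_\omega$ for all $\omega\in\Omega$, and let $\omega_0\in\Omega$. \textbf{(1) Subadditive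 families.} A proper subadditive family over $(\mathcal{Q},\vartheta)$ is a family of upper semicontinuous functions $f^t:\mathcal{Q}\to\mathbb{R}\cup\{-\infty\}$, $t\in\mathbb{T}_+$, such that $f^{t+s}(q)\le f^t(\vartheta^s(q))+f^s(q)$ for all $t,s\in\mathbb{T}_+$, $q\in\mathcal{Q}$, and $\sup_{t\in[0,1]\cap\mathbb{T}_+}\sup_{q}f^t(q)<+\infty$. For such a family the limit $\Lambda(f)=\lim_{t\to+\infty}\frac1t\sup_{q\in\mathcal{Q}}f^t(q)\in[-\infty,\infty)$ (the uniform growth exponent) exists. If $f_\omega$ is a proper subadditive family over $(\mathcal{Q},\vartheta_\omega)$ for each $\omega\in\Omega$, and for some positive $\tau\in\mathbb{T}_+$ and every integer $k>0$ $$\sup_{q\in\mathcal{B}_0}|f_\omega^{\tau k}(q)-f_{\omega_0}^{\tau k}(q)|\to0\quad\text{as }\omega\to\omega_0$$ (with $|(-\infty)-(-\infty)|=0$ and $|(-\infty)-a|=\infty$ for $a\in\mathbb{R}$), then $\limsup_{\omega\to\omega_0}\Lambda(f_\omega)\le\Lambda(f_{\omega_0})$. \textbf{Cocycles.} A uniformly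 continuous linear cocycle in a real or complex Banach space $\mathbb{E}$ over $(\mathcal{Q},\vartheta)$ is a family of bounded operators $\Xi^t(q)\in\mathcal{L}(\mathbb{E})$, $t\in\mathbb{T}_+$, $q\in\mathcal{Q}$, with $\Xi^{t+s}(q)=\Xi^t(\vartheta^s(q))\,\Xi^s(q)$, $\Xi^0(q)=\mathrm{id}$, $(t,q,v)\mapsto\Xi^t(q)v$ continuous, $q\mapsto\Xi^t(q)$ continuous in the operator norm for each $t$, and $\sup_{t\in[0,1]\cap\mathbb{T}_+}\sup_q\|\Xi^t(q)\|<\infty$. For each $\omega\in\Omega$ let $\Xi_{(\omega)}$ be such a cocycle in $\mathbb{E}$ over $(\mathcal{Q},\vartheta_\omega)$, and suppose that $\Xi_{(\omega)}$ eventually converges to $\Xi_{(\omega_0)}$ on $\mathcal{B}_0$, i.e. for some positive $\tau\in\mathbb{T}_+$ and every integer $k>0$ $$\sup_{q\in\mathcal{B}_0}\|\Xi_{(\omega_0)}^{\tau k}(q)-\Xi_{(\omega)}^{\tau k}(q)\|\to0\quad\text{as }\omega\to\omega_0.$$ \textbf{(2) Banach spaces.} The limits $\lambda_1(\Xi_{(\omega)})=\lim_{t\to+\infty}\frac1t\ln\sup_{q\in\mathcal{Q}}\|\Xi_{(\omega)}^t(q)\|$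 exist in $[-\infty,\infty)$ and $\limsup_{\omega\to\omega_0}\lambda_1(\Xi_{(\omega)})\le\lambda_1(\Xi_{(\omega_0)})$. \textbf{(3) Hilbert spaces.} Let moreover $\mathbb{E}=\mathbb{H}$ be a Hilbert space. For $L\in\mathcal{L}(\mathbb{H})$ and $k\ge1$ let $\sigma_k(L)=\sup_{\dim\mathbb{L}=k}\inf_{\xi\in\mathbb{L},|\xi|=1}|L\xi|$ ($=0$ if $k>\dim\mathbb{H}$), and for $d=m+\gamma$, $m\ge0$ an integer, $\gamma\in[0,1]$, let $\omega_d(L)=\sigma_1(L)\cdots\sigma_m(L)\,\sigma_{m+1}(L)^\gamma$ (with $0^0=1$). For a uniformly continuous linear cocycle $\Xi$ in $\mathbb{H}$ the limit $\overline{\omega}_d(\Xi)=\lim_{t\to+\infty}\big(\sup_{q\in\mathcal{Q}}\omega_d(\Xi^t(q))\big)^{1/t}$ exists; put $\dim_{\mathrm L}\Xi=\inf\{d\ge0:\overline{\omega}_d(\Xi)<1\}$ ($\inf\emptyset=\infty$). Let $\Xi_m$, $m\geq 1$, be the compound cocycle in the exterior power $\mathbb{H}^{\wedge m}$, $\Xi_m^t(q)(\xi_1\wedge\dots\wedge\xi_m)=\Xi^t(q)\xi_1\wedge\dots\wedge\Xi^t(q)\xi_m$,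 where $\mathbb{H}^{\wedge m}$ is the Hilbert space with $\langle\xi_1\wedge\dots\wedge\xi_m,\eta_1\wedge\dots\wedge\eta_m\rangle=\frac1{m!}\det[\langle\xi_j,\eta_k\rangle]$; the limits $\lambda_1(\Xi_m)=\lim_{t\to+\infty}\frac1t\ln\sup_q\|\Xi_m^t(q)\|$ exist. Define $\lambda_1(\Xi),\lambda_2(\Xi),\dots\in[-\infty,\infty)$ by $\lambda_1(\Xi)+\dots+\lambda_m(\Xi)=\lambda_1(\Xi_m)$, $m\ge1$ (with $\lambda_{m+1}(\Xi)=-\infty$ once $\lambda_1(\Xi_m)=-\infty$), and $\dim^{KY}_{\mathrm L}\Xi=m+\frac{\lambda_1(\Xi)+\dots+\lambda_m(\Xi)}{|\lambda_{m+1}(\Xi)|}$ for the largest integer $m\ge0$ with $\lambda_1(\Xi)+\dots+\lambda_m(\Xi)\ge0$ (the fraction being $0$ if $\lambda_{m+1}(\Xi)=-\infty$), and $\dim^{KY}_{\mathrm L}\Xi=\infty$ if there is no largest such $m$. Then, for all $d\ge0$, $$\limsup_{\omega\to\omega_0}\overline{\omega}_d(\Xi_{(\omega)})\le\overline{\omega}_d(\Xi_{(\omega_0)}),\quad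 \limsup_{\omega\to\omega_0}\dim^{KY}_{\mathrm L}\Xi_{(\omega)}\le\dim^{KY}_{\mathrm L}\Xi_{(\omega_0)},\quad \limsup_{\omega\to\omega_0}\dim_{\mathrm L}\Xi_{(\omega)}\le\dim_{\mathrm L}\Xi_{(\omega_0)}.$$ -/

import Mathlib

open Filter Topology Set
open scoped ENNReal

noncomputable section

namespace UniformLyapunov

/-! ### Time sets, dynamical systems, attractors

A family indexed by a time set `T ⊆ ℝ` is represented by a function of `t : ℝ` of which only the
values at `t ∈ T` (or `t ∈ T ∩ [0, ∞)`) are ever used. -/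

/-- The admissible time sets `ℤ`, `ℤ₊`, `ℝ`, `ℝ₊`. -/
def IsTimeSet (T : Set ℝ) : Prop :=
  T = range ((↑) : ℤ → ℝ) ∨ T = range ((↑) : ℕ → ℝ) ∨ T = univ ∨ T = Ici 0

/-- `T₊ = T ∩ [0, ∞)`. -/
def nonnegTimes (T : Set ℝ) : Set ℝ := T ∩ Ici 0

/-- The filter "`t → +∞` with `t ∈ T₊`". -/
def timesAtTop (T : Set ℝ) : Filter ℝ := atTop ⊓ 𝓟 (nonnegTimes T)

structure IsDynamicalSystem {Q : Type*} [TopologicalSpace Q] (T : Set ℝ) (θ : ℝ → Q → Q) :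
    Prop where
  map_zero : ∀ q, θ 0 q = q
  map_add : ∀ t ∈ T, ∀ s ∈ T, ∀ q, θ (t + s) q = θ t (θ s q)
  continuousOn : ContinuousOn (fun p : ℝ × Q => θ p.1 p.2) (T ×ˢ univ)

/-- `sup_q dist (θ^t q, A) → 0` as `t → +∞`; the distance to the empty set is `∞`. -/
def Attracts {Q : Type*} [MetricSpace Q] (T : Set ℝ) (θ : ℝ → Q → Q) (A : Set Q) : Prop :=
  Tendsto (fun t => ⨆ q, Metric.infEDist (θ t q) A) (timesAtTop T) (𝓝 0)

/-- `A` is a `2^Q`-attractor: a minimal set among the compact sets that attract `Q`. -/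
def IsAttractor {Q : Type*} [MetricSpace Q] (T : Set ℝ) (θ : ℝ → Q → Q) (A : Set Q) : Prop :=
  Minimal (fun B : Set Q => IsCompact B ∧ Attracts T θ B) A

/-! ### Subadditive families -/

/-- Proper subadditive families over `(Q, θ)`. The values lie in `ℝ ∪ {-∞}`. -/
structure IsProperSubadditive {Q : Type*} [TopologicalSpace Q] (T : Set ℝ) (θ : ℝ → Q → Q)
    (f : ℝ → Q → EReal) : Prop where
  ne_top : ∀ t ∈ nonnegTimes T, ∀ q, f t q ≠ ⊤
  upperSemicontinuous : ∀ t ∈ nonnegTimes T, UpperSemicontinuous (f t)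
  subadditive : ∀ t ∈ nonnegTimes T, ∀ s ∈ nonnegTimes T, ∀ q,
    f (t + s) q ≤ f t (θ s q) + f s q
  bounded : (⨆ t ∈ nonnegTimes T ∩ Icc 0 1, ⨆ q, f t q) < ⊤

/-- `(1/t) sup_q f^t(q)`. -/
def meanGrowth {Q : Type*} (f : ℝ → Q → EReal) (t : ℝ) : EReal :=
  (⨆ q, f t q) / (t : EReal)

/-- The uniform growth exponent `Λ(f) = lim_{t → +∞} (1/t) sup_q f^t(q)`. (It is written as an
upper limit, which is the limit whenever the latter exists.) -/
def growthExponent {Q : Type*} (T : Set ℝ) (f : ℝ → Q → EReal) : EReal :=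
  limsup (meanGrowth f) (timesAtTop T)

/-- Eventual convergence `f_ω → f_{ω₀}` on `B`: for some positive `τ ∈ T₊` and every integer
`k > 0` one has `sup_{q ∈ B} |f_ω^{τ k}(q) - f_{ω₀}^{τ k}(q)| → 0` as `ω → ω₀`, where the distance
from `-∞` to `-∞` is `0` and that from `-∞` to a real number is `∞`. -/
def FamilyEventuallyConverges {Ω Q : Type*} [TopologicalSpace Ω] (T : Set ℝ)
    (f : Ω → ℝ → Q → EReal) (ω₀ : Ω) (B : Set Q) : Prop :=
  ∃ τ ∈ nonnegTimes T, 0 < τ ∧ ∀ k : ℕ, 0 < k → ∀ ε : ℝ, 0 < ε → ∀ᶠ ω in 𝓝 ω₀, ∀ q ∈ B,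
    f ω (τ * k) q ≤ f ω₀ (τ * k) q + (ε : EReal) ∧
    f ω₀ (τ * k) q ≤ f ω (τ * k) q + (ε : EReal)

/-! ### Uniformly continuous linear cocycles -/

structure IsUniformlyContinuousCocycle {𝕜 Q E : Type*} [RCLike 𝕜] [TopologicalSpace Q]
    [NormedAddCommGroup E] [NormedSpace 𝕜 E] (T : Set ℝ) (θ : ℝ → Q → Q)
    (Ξ : ℝ → Q → E →L[𝕜] E) : Prop where
  map_zero : ∀ q v, Ξ 0 q v = v
  map_add : ∀ t ∈ nonnegTimes T, ∀ s ∈ nonnegTimes T, ∀ q v,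
    Ξ (t + s) q v = Ξ t (θ s q) (Ξ s q v)
  continuousOn : ContinuousOn (fun p : ℝ × Q × E => Ξ p.1 p.2.1 p.2.2) (nonnegTimes T ×ˢ univ)
  continuous_norm : ∀ t ∈ nonnegTimes T, Continuous (Ξ t)
  bounded : ∃ C : ℝ, ∀ t ∈ nonnegTimes T ∩ Icc 0 1, ∀ q, ‖Ξ t q‖ ≤ C

/-- Eventual convergence `Ξ_ω → Ξ_{ω₀}` on `B`: for some positive `τ ∈ T₊` and every integer
`k > 0` one has `sup_{q ∈ B} ‖Ξ_{ω₀}^{τ k}(q) - Ξ_ω^{τ k}(q)‖ → 0` as `ω → ω₀`. -/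
def CocycleEventuallyConverges {𝕜 Ω Q E : Type*} [RCLike 𝕜] [TopologicalSpace Ω]
    [NormedAddCommGroup E] [NormedSpace 𝕜 E] (T : Set ℝ) (Ξ : Ω → ℝ → Q → E →L[𝕜] E)
    (ω₀ : Ω) (B : Set Q) : Prop :=
  ∃ τ ∈ nonnegTimes T, 0 < τ ∧ ∀ k : ℕ, 0 < k →
    Tendsto (fun ω => ⨆ q ∈ B, ‖Ξ ω₀ (τ * k) q - Ξ ω (τ * k) q‖ₑ) (𝓝 ω₀) (𝓝 0)

/-- `(1/t) ln sup_q ‖Ξ^t(q)‖`, with `ln 0 = -∞`. -/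
def meanLogNorm {𝕜 Q E : Type*} [RCLike 𝕜] [NormedAddCommGroup E] [NormedSpace 𝕜 E]
    (Ξ : ℝ → Q → E →L[𝕜] E) (t : ℝ) : EReal :=
  ENNReal.log (⨆ q, ‖Ξ t q‖ₑ) / (t : EReal)

/-- The largest uniform Lyapunov exponent `λ₁(Ξ)`. -/
def largestExponent {𝕜 Q E : Type*} [RCLike 𝕜] [NormedAddCommGroup E] [NormedSpace 𝕜 E]
    (T : Set ℝ) (Ξ : ℝ → Q → E →L[𝕜] E) : EReal :=
  limsup (meanLogNorm Ξ) (timesAtTop T)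

/-! ### Singular values and the Lyapunov dimension -/

section Hilbert

variable {𝕜 H : Type*} [RCLike 𝕜] [NormedAddCommGroup H] [InnerProductSpace 𝕜 H]

/-- The `k`-th singular value, `k ≥ 1`:
the supremum over the `k`-dimensional subspaces `V` of `inf {‖L x‖ : x ∈ V, ‖x‖ = 1}`.
It is `0` if there is no such subspace. -/
def singularValue (L : H →L[𝕜] H) (k : ℕ) : ℝ :=
  sSup {r : ℝ | ∃ V : Submodule 𝕜 H, Module.finrank 𝕜 V = k ∧
    r = sInf {s : ℝ | ∃ x ∈ V, ‖x‖ = 1 ∧ s = ‖L x‖}}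

/-- The function of singular values `ω_d(L) = σ₁(L) ⋯ σ_m(L) σ_{m+1}(L)^γ` for
`d = m + γ ≥ 0`, `m = ⌊d⌋`, with `0 ^ 0 = 1`. -/
def singularFunction (d : ℝ) (L : H →L[𝕜] H) : ℝ :=
  (∏ j ∈ Finset.Icc 1 ⌊d⌋₊, singularValue L j) * singularValue L (⌊d⌋₊ + 1) ^ (d - ⌊d⌋₊)

/-- The same formula holds for every decomposition `d = m + γ` with `γ ∈ [0, 1]`. -/
theorem singularFunction_add (m : ℕ) {γ : ℝ} (h0 : 0 ≤ γ) (h1 : γ ≤ 1) (L : H →L[𝕜] H) :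
    singularFunction (m + γ) L =
      (∏ j ∈ Finset.Icc 1 m, singularValue L j) * singularValue L (m + 1) ^ γ := by
  rcases h1.lt_or_eq with h | rfl
  · have hf : ⌊(m : ℝ) + γ⌋₊ = m := by
      rw [Nat.floor_eq_iff (by positivity)]
      constructor <;> linarith
    simp [singularFunction, hf]
  · have hf : ⌊(m : ℝ) + 1⌋₊ = m + 1 := by
      exact_mod_cast Nat.floor_natCast (R := ℝ) (m + 1)
    rw [singularFunction, hf, Finset.prod_Icc_succ_top (by omega)]
    simp

/-- `(sup_q ω_d(Ξ^t(q)))^{1/t}`. -/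
def meanSingularFunction {Q : Type*} (d : ℝ) (Ξ : ℝ → Q → H →L[𝕜] H) (t : ℝ) : ℝ≥0∞ :=
  (⨆ q, ENNReal.ofReal (singularFunction d (Ξ t q))) ^ (1 / t)

/-- The averaged function of singular values `ω̄_d(Ξ)`. -/
def averagedSingularFunction {Q : Type*} (T : Set ℝ) (d : ℝ) (Ξ : ℝ → Q → H →L[𝕜] H) : ℝ≥0∞ :=
  limsup (meanSingularFunction d Ξ) (timesAtTop T)

/-- The uniform Lyapunov dimension `inf {d ≥ 0 | ω̄_d(Ξ) < 1}`, with `inf ∅ = ∞`. -/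
def lyapunovDim {Q : Type*} (T : Set ℝ) (Ξ : ℝ → Q → H →L[𝕜] H) : EReal :=
  sInf {x : EReal | ∃ d : ℝ, 0 ≤ d ∧ averagedSingularFunction T d Ξ < 1 ∧ x = (d : EReal)}

/-! ### Exterior powers, compounds and the Kaplan–Yorke dimension -/

/-- The linear functional `η₁ ∧ ⋯ ∧ η_m ↦ det [⟨ξ_k, η_j⟩]` on the `m`-th exterior power. -/
def wedgeFunctional {m : ℕ} (ξ : Fin m → H) : ⋀[𝕜]^m H →ₗ[𝕜] 𝕜 :=
  exteriorPower.alternatingMapLinearEquiv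
    ((Matrix.detRowAlternating (n := Fin m) (R := 𝕜)).compLinearMap
      (LinearMap.pi fun k => (innerSL 𝕜 (ξ k)).toLinearMap))

theorem wedgeFunctional_ιMulti {m : ℕ} (ξ η : Fin m → H) :
    wedgeFunctional (𝕜 := 𝕜) ξ (exteriorPower.ιMulti 𝕜 m η) =
      (Matrix.of fun j k => inner 𝕜 (ξ k) (η j)).det := by
  rw [wedgeFunctional, exteriorPower.alternatingMapLinearEquiv_apply_ιMulti]
  rfl

theorem wedgeFunctional_update {m : ℕ} (ξ η : Fin m → H) (i : Fin m) (a : H) :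
    wedgeFunctional (𝕜 := 𝕜) (Function.update ξ i a) (exteriorPower.ιMulti 𝕜 m η) =
      ((Matrix.of fun j k => inner 𝕜 (ξ k) (η j)).updateCol i fun j => inner 𝕜 a (η j)).det := by
  rw [wedgeFunctional_ιMulti]
  congr 1
  ext j k
  by_cases h : k = i
  · subst h; simp
  · simp [h, Matrix.updateCol_ne]

/-- The conjugate-linear functionals `conj ∘ wedgeFunctional ξ`, which depend on `ξ` in a linear
and alternating way. -/
def wedgeAlternating (𝕜 H : Type*) [RCLike 𝕜] [NormedAddCommGroup H] [InnerProductSpace 𝕜 H]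
    (m : ℕ) : H [⋀^Fin m]→ₗ[𝕜] (⋀[𝕜]^m H →ₛₗ[starRingEnd 𝕜] 𝕜) where
  toFun ξ := (starRingEnd 𝕜).toSemilinearMap.comp (wedgeFunctional ξ)
  map_update_add' := by
    intro inst ξ i a b
    have hI : inst = instDecidableEqFin m := Subsingleton.elim _ _
    subst hI
    have : wedgeFunctional (𝕜 := 𝕜) (Function.update ξ i (a + b)) =
        wedgeFunctional (Function.update ξ i a) + wedgeFunctional (Function.update ξ i b) := by
      apply exteriorPower.linearMap_ext
      ext η
      simp only [LinearMap.compAlternatingMap_apply, LinearMap.add_apply, wedgeFunctional_update,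
        inner_add_left]
      exact Matrix.det_updateCol_add _ _ _ _
    ext x
    simp [this]
  map_update_smul' := by
    intro inst ξ i c a
    have hI : inst = instDecidableEqFin m := Subsingleton.elim _ _
    subst hI
    have : wedgeFunctional (𝕜 := 𝕜) (Function.update ξ i (c • a)) =
        (starRingEnd 𝕜 c) • wedgeFunctional (Function.update ξ i a) := by
      apply exteriorPower.linearMap_ext
      ext η
      simp only [LinearMap.compAlternatingMap_apply, LinearMap.smul_apply, wedgeFunctional_update,
        inner_smul_left]
      exact Matrix.det_updateCol_smul _ _ _ _
    ext x
    simp [this]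
  map_eq_zero_of_eq' := by
    intro ξ i j h hij
    have : wedgeFunctional (𝕜 := 𝕜) ξ = 0 := by
      apply exteriorPower.linearMap_ext
      ext η
      simp only [LinearMap.compAlternatingMap_apply, wedgeFunctional_ιMulti]
      exact Matrix.det_zero_of_column_eq hij fun k => by simp [h]
    ext x
    simp [this]

/-- The inner product of the exterior power, determined by
`⟨ξ₁ ∧ ⋯ ∧ ξ_m, η₁ ∧ ⋯ ∧ η_m⟩ = (1/m!) det [⟨ξ_j, η_k⟩]` and sesquilinearity. -/
def wedgeInner {m : ℕ} (x y : ⋀[𝕜]^m H) : 𝕜 :=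
  ((m.factorial : 𝕜))⁻¹ *
    exteriorPower.alternatingMapLinearEquiv (wedgeAlternating 𝕜 H m) y x

theorem wedgeInner_ιMulti {m : ℕ} (ξ η : Fin m → H) :
    wedgeInner (exteriorPower.ιMulti 𝕜 m ξ) (exteriorPower.ιMulti 𝕜 m η) =
      ((m.factorial : 𝕜))⁻¹ * (Matrix.of fun j k => inner 𝕜 (ξ j) (η k)).det := by
  rw [wedgeInner, exteriorPower.alternatingMapLinearEquiv_apply_ιMulti]
  congr 1
  change starRingEnd 𝕜 (wedgeFunctional η (exteriorPower.ιMulti 𝕜 m ξ)) = _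
  rw [wedgeFunctional_ιMulti, RingHom.map_det]
  congr 1
  ext j k
  simp

/-- The norm of the exterior power. -/
def wedgeNorm {m : ℕ} (x : ⋀[𝕜]^m H) : ℝ :=
  Real.sqrt (RCLike.re (wedgeInner x x))

/-- The operator norm of the `m`-fold multiplicative compound
`L^{∧m} (ξ₁ ∧ ⋯ ∧ ξ_m) = L ξ₁ ∧ ⋯ ∧ L ξ_m`. The Hilbert space `H^{∧m}` is the completion of the
algebraic exterior power, so the norm of `L^{∧m}` is its least bound on the latter. -/
def compoundNorm (m : ℕ) (L : H →L[𝕜] H) : ℝ :=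
  sInf {c : ℝ | 0 ≤ c ∧ ∀ x : ⋀[𝕜]^m H,
    wedgeNorm (exteriorPower.map m (L : H →ₗ[𝕜] H) x) ≤ c * wedgeNorm x}

/-- `(1/t) ln sup_q ‖Ξ_m^t(q)‖` for the `m`-fold compound cocycle `Ξ_m`, with `ln 0 = -∞`. -/
def meanLogCompoundNorm {Q : Type*} (m : ℕ) (Ξ : ℝ → Q → H →L[𝕜] H) (t : ℝ) : EReal :=
  ENNReal.log (⨆ q, ENNReal.ofReal (compoundNorm m (Ξ t q))) / (t : EReal)

/-- The largest uniform Lyapunov exponent `λ₁(Ξ_m)` of the `m`-fold compound cocycle. -/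
def compoundExponent {Q : Type*} (T : Set ℝ) (Ξ : ℝ → Q → H →L[𝕜] H) (m : ℕ) : EReal :=
  limsup (meanLogCompoundNorm m Ξ) (timesAtTop T)

/-- The uniform Lyapunov exponents `λ_m(Ξ)`, `m ≥ 1`, determined by
`λ₁(Ξ) + ⋯ + λ_m(Ξ) = λ₁(Ξ_m)`; once `λ₁(Ξ_m) = -∞`, all further exponents are `-∞`
(note that `-∞ - (-∞) = -∞` in `EReal`). -/
def uniformExponent {Q : Type*} (T : Set ℝ) (Ξ : ℝ → Q → H →L[𝕜] H) : ℕ → EReal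
  | 0 => 0
  | 1 => compoundExponent T Ξ 1
  | m + 2 => compoundExponent T Ξ (m + 2) - compoundExponent T Ξ (m + 1)

/-- `λ₁(Ξ) + ⋯ + λ_m(Ξ)`. -/
def exponentSum {Q : Type*} (T : Set ℝ) (Ξ : ℝ → Q → H →L[𝕜] H) (m : ℕ) : EReal :=
  ∑ j ∈ Finset.Icc 1 m, uniformExponent T Ξ j

open Classical in
/-- The uniform Kaplan–Yorke dimension: `m + (λ₁ + ⋯ + λ_m) / |λ_{m+1}|` for the largest `m ≥ 0`
with `λ₁ + ⋯ + λ_m ≥ 0`, and `∞` if there is no largest such `m`. The quotient is `0` if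
`λ_{m+1} = -∞`. -/
def kaplanYorkeDim {Q : Type*} (T : Set ℝ) (Ξ : ℝ → Q → H →L[𝕜] H) : EReal :=
  if h : ∃ m : ℕ, IsGreatest {m : ℕ | 0 ≤ exponentSum T Ξ m} m then
    (h.choose : EReal) +
      exponentSum T Ξ h.choose / ((uniformExponent T Ξ (h.choose + 1)).abs : EReal)
  else ⊤

end Hilbert

end UniformLyapunov

end

namespace UniformLyapunov

/-! ### Nonnegative times -/

section Times

variable {T : Set ℝ}

/-! By Fekete's argument `Λ(f)` is a lower bound for all the means `(1/s) sup_q f^s(q)`, and it is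
their limit. So `Λ(f_{ω₀}) < z` already shows at a single time `s = τk`, and a strict inequality at
one fixed time survives a small perturbation of the family.

The perturbation is controlled on `B₀` only. This suffices because an initial stretch of the orbit
does not affect the exponent: it is enough to bound `f^s` on `θ^t(Q)` for all large `t`. If `f^s <
M` on a compact attracting set, upper semicontinuity gives the same bound on a neighbourhood of it,
which eventually contains `θ^t(Q)`. No uniformity in `ω` of the neighbourhood or of the entry time
is needed.

Cocycles reduce to this through `ln Φ(Ξ^t(q))`, with `Φ` submultiplicative and uniformly continuous
on bounded sets. For the norm this is immediate. For `ω_d` submultiplicativity is Horn's inequality.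
It follows from `‖L^{∧m}‖ = σ₁ ⋯ σ_m`, proved with singular bases of finite-dimensional subspaces
(`wedgeNorm_map_le`, `prod_singularValue_le_of_bound`), since `L` itself need not have singular
vectors.

Both dimension statements then hold because `dim < z` follows from finitely many strict upper bounds
on exponents, which persist near `ω₀`, and such bounds in turn bound the dimension. -/

theorem IsTimeSet.nonnegTimes_eq (hT : IsTimeSet T) :
    nonnegTimes T = range ((↑) : ℕ → ℝ) ∨ nonnegTimes T = Ici 0 := by
  rcases hT with rfl | rfl | rfl | rfl
  · left
    ext x
    constructor
    · rintro ⟨⟨n, rfl⟩, hn⟩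
      have hn' : 0 ≤ n := by exact_mod_cast (show (0 : ℝ) ≤ n from hn)
      exact ⟨n.toNat, by exact_mod_cast Int.toNat_of_nonneg hn'⟩
    · rintro ⟨n, rfl⟩
      exact ⟨⟨n, by simp⟩, by simp⟩
  · left
    ext x
    constructor
    · exact fun h => h.1
    · rintro ⟨n, rfl⟩
      exact ⟨⟨n, rfl⟩, by simp⟩
  · right; simp [nonnegTimes]
  · right; simp [nonnegTimes]

theorem nonneg_of_mem_nonnegTimes {t : ℝ} (ht : t ∈ nonnegTimes T) : 0 ≤ t := ht.2

theorem IsTimeSet.natCast_mem (hT : IsTimeSet T) (n : ℕ) : (n : ℝ) ∈ nonnegTimes T := by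
  rcases hT.nonnegTimes_eq with h | h <;> rw [h]
  · exact ⟨n, rfl⟩
  · simp

theorem IsTimeSet.add_mem (hT : IsTimeSet T) {s t : ℝ} (hs : s ∈ nonnegTimes T)
    (ht : t ∈ nonnegTimes T) : s + t ∈ nonnegTimes T := by
  rcases hT.nonnegTimes_eq with h | h <;> rw [h] at hs ht ⊢
  · obtain ⟨m, rfl⟩ := hs
    obtain ⟨n, rfl⟩ := ht
    exact ⟨m + n, by push_cast; rfl⟩
  · exact add_nonneg (mem_Ici.1 hs) (mem_Ici.1 ht)

theorem IsTimeSet.sub_mem (hT : IsTimeSet T) {s t : ℝ} (hs : s ∈ nonnegTimes T)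
    (ht : t ∈ nonnegTimes T) (hst : s ≤ t) : t - s ∈ nonnegTimes T := by
  rcases hT.nonnegTimes_eq with h | h <;> rw [h] at hs ht ⊢
  · obtain ⟨m, rfl⟩ := hs
    obtain ⟨n, rfl⟩ := ht
    exact ⟨n - m, Nat.cast_sub (by exact_mod_cast hst)⟩
  · exact sub_nonneg.2 hst

theorem IsTimeSet.natCast_mul_mem (hT : IsTimeSet T) {s : ℝ} (hs : s ∈ nonnegTimes T) (n : ℕ) :
    (n : ℝ) * s ∈ nonnegTimes T := by
  induction n with
  | zero => simpa using hT.natCast_mem 0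
  | succ n ih =>
    rw [Nat.cast_succ, add_mul, one_mul]
    exact hT.add_mem ih hs

theorem IsTimeSet.timesAtTop_neBot (hT : IsTimeSet T) : (timesAtTop T).NeBot := by
  rw [timesAtTop, ← frequently_mem_iff_neBot, frequently_atTop]
  intro a
  obtain ⟨n, hn⟩ := exists_nat_ge a
  exact ⟨n, hn, hT.natCast_mem n⟩

theorem eventually_timesAtTop {p : ℝ → Prop} (a : ℝ) (h : ∀ t ∈ nonnegTimes T, a ≤ t → p t) :
    ∀ᶠ t in timesAtTop T, p t := by
  rw [timesAtTop, eventually_inf_principal]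
  filter_upwards [eventually_ge_atTop a] with t hat hT using h t hT hat

theorem exists_forall_of_eventually_timesAtTop (hT : IsTimeSet T) {p : ℝ → Prop}
    (h : ∀ᶠ t in timesAtTop T, p t) :
    ∃ a ∈ nonnegTimes T, ∀ t ∈ nonnegTimes T, a ≤ t → p t := by
  rw [timesAtTop, eventually_inf_principal, eventually_atTop] at h
  obtain ⟨a, ha⟩ := h
  obtain ⟨n, hn⟩ := exists_nat_ge a
  exact ⟨n, hT.natCast_mem n, fun t ht hnt => ha t (hn.trans hnt) ht⟩

theorem timesAtTop_le_atTop : timesAtTop T ≤ atTop := inf_le_left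

end Times

/-! ### Growth exponents of subadditive families -/

section Subadditive

variable {Q : Type*} [TopologicalSpace Q] {T : Set ℝ} {θ : ℝ → Q → Q} {f : ℝ → Q → EReal}

theorem IsProperSubadditive.exists_bound (hf : IsProperSubadditive T θ f) (hT : IsTimeSet T)
    (n : ℕ) : ∃ C : ℝ, 0 ≤ C ∧ ∀ t ∈ nonnegTimes T, t ≤ n → ∀ q, f t q ≤ (C : EReal) := by
  obtain ⟨C, hC⟩ : ∃ C : ℝ, ∀ t ∈ nonnegTimes T, t ≤ 1 → ∀ q, f t q ≤ (C : EReal) := by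
    obtain ⟨C, hC, -⟩ := EReal.lt_iff_exists_real_btwn.1 hf.bounded
    refine ⟨C, fun t ht ht1 q => le_trans ?_ hC.le⟩
    exact le_iSup₂_of_le t ⟨ht, ht.2, ht1⟩ (le_iSup (f t) q)
  have hC' : ∀ t ∈ nonnegTimes T, t ≤ 1 → ∀ q, f t q ≤ ((max C 0 : ℝ) : EReal) :=
    fun t ht ht1 q => (hC t ht ht1 q).trans (EReal.coe_le_coe (le_max_left _ _))
  induction n with
  | zero =>
    refine ⟨max C 0, le_max_right _ _, fun t ht htn q => hC' t ht ?_ q⟩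
    exact htn.trans (by simp)
  | succ n ih =>
    obtain ⟨D, hD0, hD⟩ := ih
    refine ⟨max C 0 + D, by positivity, fun t ht htn q => ?_⟩
    by_cases h1 : t ≤ 1
    · exact (hC' t ht h1 q).trans (EReal.coe_le_coe (le_add_of_nonneg_right hD0))
    · push Not at h1
      have h1T : (1 : ℝ) ∈ nonnegTimes T := by simpa using hT.natCast_mem 1
      have hsub := hT.sub_mem h1T ht h1.le
      have := hf.subadditive _ h1T _ hsub q
      rw [add_sub_cancel] at this
      refine this.trans ?_
      rw [EReal.coe_add]
      refine add_le_add (hC' 1 h1T le_rfl _) (hD _ hsub ?_ q)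
      push_cast at htn
      linarith

/-- Subadditivity is iterated along the orbit from time `u` on, so `f s` is evaluated only at points
`θ t q` with `t ≥ t₀`. -/
theorem IsProperSubadditive.le_natCast_mul_add (hf : IsProperSubadditive T θ f) (hT : IsTimeSet T)
    {s : ℝ} (hs : s ∈ nonnegTimes T) {t₀ : ℝ} {M : ℝ}
    (hM : ∀ t ∈ nonnegTimes T, t₀ ≤ t → ∀ q, f s (θ t q) ≤ (M : EReal))
    {u : ℝ} (hu : u ∈ nonnegTimes T) (hu₀ : t₀ ≤ u) (n : ℕ) (q : Q) :
    f (n * s + u) q ≤ ((n * M : ℝ) : EReal) + f u q := by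
  induction n with
  | zero => simp
  | succ n ih =>
    have hn := hT.natCast_mul_mem hs n
    have := hf.subadditive s hs _ (hT.add_mem hn hu) q
    rw [show s + (n * s + u) = ((n + 1 : ℕ) : ℝ) * s + u by push_cast; ring] at this
    refine this.trans ((add_le_add (hM _ (hT.add_mem hn hu) ?_ q) ih).trans ?_)
    · linarith [nonneg_of_mem_nonnegTimes hn]
    · rw [← add_assoc, ← EReal.coe_add]
      exact add_le_add (EReal.coe_le_coe (le_of_eq (by push_cast; ring))) le_rfl

/-- Fekete's argument with a delay: `t = n s + u` with `t₀ ≤ u < t₀ + s`. The piece of length `u`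
costs a bounded amount, which disappears after division by `t`. -/
theorem IsProperSubadditive.growthExponent_le_of_eventually_le (hf : IsProperSubadditive T θ f)
    (hT : IsTimeSet T) {s : ℝ} (hs : s ∈ nonnegTimes T) (hs0 : 0 < s) {M : ℝ}
    (hM : ∀ᶠ t in timesAtTop T, ∀ q, f s (θ t q) ≤ (M : EReal)) :
    growthExponent T f ≤ ((M / s : ℝ) : EReal) := by
  obtain ⟨t₀, ht₀, hM⟩ := exists_forall_of_eventually_timesAtTop hT hM
  obtain ⟨N, hN⟩ := exists_nat_ge (t₀ + s)
  obtain ⟨C, hC0, hC⟩ := hf.exists_bound hT N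
  have key : ∀ t ∈ nonnegTimes T, t₀ ≤ t → ∀ q,
      f t q ≤ ((t * (M / s) + (|M| * (t₀ + s) / s + C) : ℝ) : EReal) := by
    intro t ht htt q
    set n := ⌊(t - t₀) / s⌋₊ with hn
    have h0 : 0 ≤ (t - t₀) / s := div_nonneg (sub_nonneg.2 htt) hs0.le
    have h1 : n * s ≤ t - t₀ := (le_div_iff₀ hs0).1 (Nat.floor_le h0)
    have h2 : t - t₀ < (n + 1) * s := (div_lt_iff₀ hs0).1 (Nat.lt_floor_add_one _)
    have hns := hT.natCast_mul_mem hs n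
    have ht₀' := nonneg_of_mem_nonnegTimes ht₀
    have hu := hT.sub_mem hns ht (by linarith)
    have h3 := hf.le_natCast_mul_add hT hs hM hu (by linarith) n q
    rw [add_sub_cancel] at h3
    refine h3.trans ((add_le_add le_rfl (hC _ hu (by linarith) q)).trans ?_)
    rw [← EReal.coe_add]
    refine EReal.coe_le_coe ?_
    rw [← add_assoc]
    refine add_le_add ?_ le_rfl
    -- Here `n s - t = -u` with `0 ≤ u ≤ t₀ + s`; the sign of `M` is unknown, hence `|M|`.
    have h4 : (n * s - t) * M ≤ |M| * (t₀ + s) := by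
      refine (le_abs_self _).trans ?_
      rw [abs_mul, mul_comm]
      refine mul_le_mul_of_nonneg_left ?_ (abs_nonneg _)
      rw [abs_le]
      constructor <;> linarith
    have h5 : n * M = t * (M / s) + (n * s - t) * M / s := by field_simp; ring
    rw [h5]
    exact add_le_add le_rfl ((div_le_div_iff_of_pos_right hs0).2 h4)
  set D := |M| * (t₀ + s) / s + C
  have hlim : Tendsto (fun t : ℝ => ((M / s + D / t : ℝ) : EReal)) (timesAtTop T)
      (𝓝 ((M / s : ℝ) : EReal)) := by
    refine continuous_coe_real_ereal.continuousAt.tendsto.comp ?_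
    have : Tendsto (fun t : ℝ => M / s + D / t) atTop (𝓝 (M / s + 0)) :=
      tendsto_const_nhds.add (tendsto_const_nhds.div_atTop tendsto_id)
    rw [add_zero] at this
    exact this.mono_left timesAtTop_le_atTop
  have := hT.timesAtTop_neBot
  rw [← hlim.limsup_eq]
  refine limsup_le_limsup (eventually_timesAtTop (max t₀ 1) fun t ht htt => ?_)
  have htt1 : 1 ≤ t := (le_max_right _ _).trans htt
  have ht0 : 0 < t := by linarith
  have hsup : (⨆ q, f t q) ≤ ((t * (M / s) + D : ℝ) : EReal) :=
    iSup_le fun q => key t ht ((le_max_left _ _).trans htt) q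
  refine (EReal.div_le_div_right_of_nonneg (EReal.coe_nonneg.2 ht0.le) hsup).trans (le_of_eq ?_)
  rw [← EReal.coe_div]
  congr 1
  field_simp

/-- The case of a bound valid on all of `Q`. As the upper limit lies below every mean, it lies below
the lower limit too, so the limit exists. Comparison with real `z` covers the value `-∞`. -/
theorem IsProperSubadditive.growthExponent_le_meanGrowth (hf : IsProperSubadditive T θ f)
    (hT : IsTimeSet T) {s : ℝ} (hs : s ∈ nonnegTimes T) (hs0 : 0 < s) :
    growthExponent T f ≤ meanGrowth f s := by
  refine EReal.le_of_forall_lt_iff_le.1 fun z hz => ?_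
  rw [meanGrowth, EReal.div_lt_iff (EReal.coe_pos.2 hs0) (EReal.coe_ne_top _), ← EReal.coe_mul]
    at hz
  have := hf.growthExponent_le_of_eventually_le hT hs hs0 (M := z * s)
    (Eventually.of_forall fun t q => (le_iSup (f s) _).trans hz.le)
  rwa [mul_div_cancel_right₀ _ hs0.ne'] at this

theorem IsProperSubadditive.tendsto_meanGrowth (hf : IsProperSubadditive T θ f)
    (hT : IsTimeSet T) :
    Tendsto (meanGrowth f) (timesAtTop T) (𝓝 (growthExponent T f)) := by
  refine tendsto_of_le_liminf_of_limsup_le ?_ le_rfl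
  refine le_liminf_of_le (by isBoundedDefault) (eventually_timesAtTop 1 fun t ht h1 => ?_)
  exact hf.growthExponent_le_meanGrowth hT ht (by linarith)

theorem IsProperSubadditive.growthExponent_lt_top (hf : IsProperSubadditive T θ f)
    (hT : IsTimeSet T) : growthExponent T f < ⊤ := by
  obtain ⟨C, -, hC⟩ := hf.exists_bound hT 1
  have h1 : (1 : ℝ) ∈ nonnegTimes T := by simpa using hT.natCast_mem 1
  refine (hf.growthExponent_le_of_eventually_le hT h1 one_pos (M := C)
    (Eventually.of_forall fun t q => hC 1 h1 (by simp) _)).trans_lt (EReal.coe_lt_top _)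

end Subadditive

/-! ### Localisation to compact attracting sets and semicontinuity in the parameter -/

section Attractor

variable {Q : Type*} [MetricSpace Q] {T : Set ℝ} {θ : ℝ → Q → Q} {f : ℝ → Q → EReal}

/-- The growth exponent is controlled by the values on a compact attracting set. -/
theorem IsProperSubadditive.growthExponent_le_of_attracts (hf : IsProperSubadditive T θ f)
    (hT : IsTimeSet T) {A : Set Q} (hA : IsCompact A) (hAt : Attracts T θ A) {s : ℝ}
    (hs : s ∈ nonnegTimes T) (hs0 : 0 < s) {M : ℝ} (hM : ∀ q ∈ A, f s q < (M : EReal)) :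
    growthExponent T f ≤ ((M / s : ℝ) : EReal) := by
  -- The set where `f s < M` is open and contains the compact set `A`, hence also some
  -- `δ`-thickening of it, which all orbits enter after a common time.
  obtain ⟨δ, hδ, hsub⟩ := hA.exists_thickening_subset_open
    ((hf.upperSemicontinuous s hs).isOpen_preimage (M : EReal)) hM
  refine hf.growthExponent_le_of_eventually_le hT hs hs0 ?_
  filter_upwards [hAt.eventually_lt_const (ENNReal.ofReal_pos.2 hδ)] with t ht q
  exact le_of_lt (hsub ((le_iSup (fun q => Metric.infEDist (θ t q) A) q).trans_lt ht))

variable {Ω : Type*} [TopologicalSpace Ω]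

/-- Upper semicontinuity of growth exponents under one-sided eventual control of the families on
a set that contains all attractors. -/
theorem limsup_growthExponent_le (hT : IsTimeSet T) {θ : Ω → ℝ → Q → Q} {A : Ω → Set Q}
    (hA : ∀ ω, IsAttractor T (θ ω) (A ω)) {B₀ : Set Q} (hB₀ : ∀ ω, A ω ⊆ B₀) (ω₀ : Ω)
    {f : Ω → ℝ → Q → EReal} (hf : ∀ ω, IsProperSubadditive T (θ ω) (f ω)) {τ : ℝ}
    (hτ : τ ∈ nonnegTimes T) (hτ0 : 0 < τ)
    (hconv : ∀ k : ℕ, 0 < k → ∀ M : ℝ, (⨆ q, f ω₀ (τ * k) q) < (M : EReal) →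
      ∀ᶠ ω in 𝓝 ω₀, ∀ q ∈ B₀, f ω (τ * k) q < (M : EReal)) :
    limsup (fun ω => growthExponent T (f ω)) (𝓝 ω₀) ≤ growthExponent T (f ω₀) := by
  refine EReal.le_of_forall_lt_iff_le.1 fun z hz => ?_
  obtain ⟨a, -, ha⟩ := exists_forall_of_eventually_timesAtTop hT
    (((hf ω₀).tendsto_meanGrowth hT).eventually_lt_const hz)
  -- `k ≥ a / τ` makes the mean at time `τ k` smaller than `z`; `k ≥ 1` makes this time positive.
  obtain ⟨k, hk⟩ := exists_nat_ge (max (a / τ) 1)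
  have hk1 : (1 : ℝ) ≤ k := (le_max_right _ _).trans hk
  have hk0 : 0 < k := by exact_mod_cast zero_lt_one.trans_le hk1
  have hs : τ * k ∈ nonnegTimes T := mul_comm τ k ▸ hT.natCast_mul_mem hτ k
  have hs0 : 0 < τ * k := by positivity
  have hlt := ha _ hs ((div_le_iff₀' hτ0).1 ((le_max_left _ _).trans hk))
  rw [meanGrowth, EReal.div_lt_iff (EReal.coe_pos.2 hs0) (EReal.coe_ne_top _),
    ← EReal.coe_mul] at hlt
  refine limsup_le_of_le (by isBoundedDefault) ?_
  filter_upwards [hconv k hk0 _ hlt] with ω hω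
  have := (hf ω).growthExponent_le_of_attracts hT (hA ω).prop.1 (hA ω).prop.2 hs hs0
    fun q hq => hω q (hB₀ ω hq)
  rwa [mul_div_cancel_right₀ _ hs0.ne'] at this

theorem limsup_growthExponent_le_of_eventuallyConverges (hT : IsTimeSet T) {θ : Ω → ℝ → Q → Q}
    {A : Ω → Set Q} (hA : ∀ ω, IsAttractor T (θ ω) (A ω)) {B₀ : Set Q} (hB₀ : ∀ ω, A ω ⊆ B₀)
    (ω₀ : Ω) {f : Ω → ℝ → Q → EReal} (hf : ∀ ω, IsProperSubadditive T (θ ω) (f ω))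
    (hconv : FamilyEventuallyConverges T f ω₀ B₀) :
    limsup (fun ω => growthExponent T (f ω)) (𝓝 ω₀) ≤ growthExponent T (f ω₀) := by
  obtain ⟨τ, hτ, hτ0, hconv⟩ := hconv
  refine limsup_growthExponent_le hT hA hB₀ ω₀ hf hτ hτ0 fun k hk M hM => ?_
  -- The supremum may be `-∞`, so the room below `M` is measured from a real `z`.
  obtain ⟨z, hz, hzM⟩ := EReal.lt_iff_exists_real_btwn.1 hM
  have hzM' : z < M := EReal.coe_lt_coe_iff.1 hzM
  filter_upwards [hconv k hk ((M - z) / 2) (by linarith)] with ω hω q hq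
  refine (hω q hq).1.trans_lt ?_
  refine (add_le_add ((le_iSup (f ω₀ (τ * k)) q).trans hz.le) le_rfl).trans_lt ?_
  rw [← EReal.coe_add, EReal.coe_lt_coe_iff]
  linarith

end Attractor

/-! ### Submultiplicative functionals of cocycles -/

theorem log_ofReal_lt_coe_iff {x M : ℝ} :
    ENNReal.log (ENNReal.ofReal x) < (M : EReal) ↔ x < Real.exp M := by
  have hM : (M : EReal) = ENNReal.log (ENNReal.ofReal (Real.exp M)) := by
    rw [ENNReal.log_ofReal_of_pos (Real.exp_pos M), Real.log_exp]
  rw [hM, ENNReal.log_lt_log_iff, ENNReal.ofReal_lt_ofReal_iff (Real.exp_pos M)]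

theorem log_ofReal_le_coe_iff {x M : ℝ} :
    ENNReal.log (ENNReal.ofReal x) ≤ (M : EReal) ↔ x ≤ Real.exp M := by
  have hM : (M : EReal) = ENNReal.log (ENNReal.ofReal (Real.exp M)) := by
    rw [ENNReal.log_ofReal_of_pos (Real.exp_pos M), Real.log_exp]
  rw [hM, ENNReal.log_le_log_iff, ENNReal.ofReal_le_ofReal_iff (Real.exp_pos M).le]

theorem log_iSup {ι : Sort*} (g : ι → ℝ≥0∞) :
    ENNReal.log (⨆ i, g i) = ⨆ i, ENNReal.log (g i) :=
  ENNReal.logOrderIso.map_iSup g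

section Functional

variable {𝕜 E : Type*} [RCLike 𝕜] [NormedAddCommGroup E] [NormedSpace 𝕜 E]

/-- Nonnegative submultiplicative functions of bounded operators that are bounded and uniformly
continuous on bounded sets. -/
structure IsSubmultiplicativeFunctional (Φ : (E →L[𝕜] E) → ℝ) : Prop where
  nonneg : ∀ L, 0 ≤ Φ L
  comp_le : ∀ L L', Φ (L.comp L') ≤ Φ L * Φ L'
  bounded : ∀ C, ∃ D, ∀ L, ‖L‖ ≤ C → Φ L ≤ D
  uniformContinuousOn : ∀ C, UniformContinuousOn Φ (Metric.closedBall 0 C)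

theorem isSubmultiplicativeFunctional_norm :
    IsSubmultiplicativeFunctional (fun L : E →L[𝕜] E => ‖L‖) where
  nonneg _ := norm_nonneg _
  comp_le L L' := L.opNorm_comp_le L'
  bounded C := ⟨C, fun _ h => h⟩
  uniformContinuousOn _ := uniformContinuous_norm.uniformContinuousOn

theorem IsSubmultiplicativeFunctional.continuous {Φ : (E →L[𝕜] E) → ℝ}
    (hΦ : IsSubmultiplicativeFunctional Φ) : Continuous Φ := by
  refine continuous_iff_continuousAt.2 fun L => ?_
  refine (hΦ.uniformContinuousOn (‖L‖ + 1)).continuousOn.continuousAt ?_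
  refine Filter.mem_of_superset (Metric.ball_mem_nhds L one_pos) fun L' h => ?_
  rw [mem_closedBall_zero_iff]
  have := norm_le_norm_add_norm_sub' L' L
  rw [Metric.mem_ball, dist_eq_norm] at h
  linarith

/-- The family `ln Φ(Ξ^t(q))`. -/
noncomputable def logFamily {Q : Type*} (Φ : (E →L[𝕜] E) → ℝ) (Ξ : ℝ → Q → E →L[𝕜] E) (t : ℝ)
    (q : Q) : EReal :=
  ENNReal.log (ENNReal.ofReal (Φ (Ξ t q)))

theorem meanGrowth_logFamily {Q : Type*} (Φ : (E →L[𝕜] E) → ℝ) (Ξ : ℝ → Q → E →L[𝕜] E) (t : ℝ) :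
    meanGrowth (logFamily Φ Ξ) t =
      ENNReal.log (⨆ q, ENNReal.ofReal (Φ (Ξ t q))) / (t : EReal) := by
  rw [meanGrowth, log_iSup]
  rfl

theorem meanLogNorm_eq {Q : Type*} (Ξ : ℝ → Q → E →L[𝕜] E) :
    meanLogNorm Ξ = meanGrowth (logFamily (fun L => ‖L‖) Ξ) := by
  ext t
  rw [meanGrowth_logFamily]
  simp only [meanLogNorm, ofReal_norm]

theorem IsSubmultiplicativeFunctional.isProperSubadditive {Φ : (E →L[𝕜] E) → ℝ}
    (hΦ : IsSubmultiplicativeFunctional Φ) {Q : Type*} [TopologicalSpace Q] {T : Set ℝ}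
    {θ : ℝ → Q → Q} {Ξ : ℝ → Q → E →L[𝕜] E} (hΞ : IsUniformlyContinuousCocycle T θ Ξ) :
    IsProperSubadditive T θ (logFamily Φ Ξ) where
  ne_top t _ q := by simp [logFamily, -ENNReal.log_ofReal]
  upperSemicontinuous t ht :=
    (ENNReal.continuous_log.comp (ENNReal.continuous_ofReal.comp
      (hΦ.continuous.comp (hΞ.continuous_norm t ht)))).upperSemicontinuous
  subadditive t ht s hs q := by
    have : Ξ (t + s) q = (Ξ t (θ s q)).comp (Ξ s q) :=
      ContinuousLinearMap.ext fun v => hΞ.map_add t ht s hs q v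
    rw [logFamily, logFamily, logFamily, ← ENNReal.log_mul_add,
      ← ENNReal.ofReal_mul (hΦ.nonneg _), this]
    exact ENNReal.log_le_log (ENNReal.ofReal_le_ofReal (hΦ.comp_le _ _))
  bounded := by
    obtain ⟨C, hC⟩ := hΞ.bounded
    obtain ⟨D, hD⟩ := hΦ.bounded C
    refine lt_of_le_of_lt (b := ENNReal.log (ENNReal.ofReal D)) ?_ (by simp [-ENNReal.log_ofReal])
    exact iSup₂_le fun t ht => iSup_le fun q =>
      ENNReal.log_le_log (ENNReal.ofReal_le_ofReal (hD _ (hC t ht q)))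

theorem IsUniformlyContinuousCocycle.exists_norm_le {Q : Type*} [TopologicalSpace Q] {T : Set ℝ}
    (hT : IsTimeSet T) {θ : ℝ → Q → Q} {Ξ : ℝ → Q → E →L[𝕜] E}
    (hΞ : IsUniformlyContinuousCocycle T θ Ξ) {t : ℝ} (ht : t ∈ nonnegTimes T) :
    ∃ C, ∀ q, ‖Ξ t q‖ ≤ C := by
  obtain ⟨n, hn⟩ := exists_nat_ge t
  obtain ⟨C, -, hC⟩ :=
    (isSubmultiplicativeFunctional_norm.isProperSubadditive hΞ).exists_bound hT n
  exact ⟨Real.exp C, fun q => log_ofReal_le_coe_iff.1 (hC t ht hn q)⟩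

/-- Closeness of operators does not make logarithms close where `Φ` is near `0`. Only the upper
bound `Φ < exp M` is therefore transferred, which is all that `limsup_growthExponent_le` requires.
-/
theorem IsSubmultiplicativeFunctional.limsup_growthExponent_le {Φ : (E →L[𝕜] E) → ℝ}
    (hΦ : IsSubmultiplicativeFunctional Φ) {Ω Q : Type*} [TopologicalSpace Ω] [MetricSpace Q]
    {T : Set ℝ} (hT : IsTimeSet T) {θ : Ω → ℝ → Q → Q} {A : Ω → Set Q}
    (hA : ∀ ω, IsAttractor T (θ ω) (A ω)) {B₀ : Set Q} (hB₀ : ∀ ω, A ω ⊆ B₀) (ω₀ : Ω)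
    {Ξ : Ω → ℝ → Q → E →L[𝕜] E} (hΞ : ∀ ω, IsUniformlyContinuousCocycle T (θ ω) (Ξ ω))
    (hconv : CocycleEventuallyConverges T Ξ ω₀ B₀) :
    limsup (fun ω => growthExponent T (logFamily Φ (Ξ ω))) (𝓝 ω₀) ≤
      growthExponent T (logFamily Φ (Ξ ω₀)) := by
  obtain ⟨τ, hτ, hτ0, hconv⟩ := hconv
  refine UniformLyapunov.limsup_growthExponent_le hT hA hB₀ ω₀
    (fun ω => hΦ.isProperSubadditive (hΞ ω)) hτ hτ0 fun k hk M hM => ?_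
  have hs : τ * k ∈ nonnegTimes T := mul_comm τ k ▸ hT.natCast_mul_mem hτ k
  obtain ⟨C, hC⟩ := (hΞ ω₀).exists_norm_le hT hs
  obtain ⟨z, hz, hzM⟩ := EReal.lt_iff_exists_real_btwn.1 hM
  have hzM' : Real.exp z < Real.exp M := Real.exp_lt_exp.2 (EReal.coe_lt_coe_iff.1 hzM)
  -- The ball of radius `C + 1` contains both operators as soon as they differ by less than `1`.
  obtain ⟨δ, hδ, hδΦ⟩ := Metric.uniformContinuousOn_iff.1 (hΦ.uniformContinuousOn (C + 1))
    (Real.exp M - Real.exp z) (sub_pos.2 hzM')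
  filter_upwards [(hconv k hk).eventually_lt_const
    (ENNReal.ofReal_pos.2 (lt_min hδ one_pos))] with ω hω q hq
  have h1 : ‖Ξ ω₀ (τ * k) q - Ξ ω (τ * k) q‖ < min δ 1 := by
    have := (le_iSup₂ (f := fun q (_ : q ∈ B₀) => ‖Ξ ω₀ (τ * k) q - Ξ ω (τ * k) q‖ₑ)
      q hq).trans_lt hω
    rw [← ofReal_norm] at this
    exact (ENNReal.ofReal_lt_ofReal_iff (lt_min hδ one_pos)).1 this
  have h2 : ‖Ξ ω (τ * k) q‖ ≤ C + 1 := by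
    have := norm_le_norm_add_norm_sub (Ξ ω₀ (τ * k) q) (Ξ ω (τ * k) q)
    linarith [hC q, h1.trans_le (min_le_right _ _)]
  have h3 := hδΦ (Ξ ω (τ * k) q) (mem_closedBall_zero_iff.2 h2) (Ξ ω₀ (τ * k) q)
    (mem_closedBall_zero_iff.2 (by linarith [hC q]))
    (by rw [dist_comm, dist_eq_norm]; exact h1.trans_le (min_le_left _ _))
  have h4 : Φ (Ξ ω₀ (τ * k) q) ≤ Real.exp z :=
    log_ofReal_le_coe_iff.1 ((le_iSup (logFamily Φ (Ξ ω₀) (τ * k)) q).trans hz.le)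
  rw [Real.dist_eq] at h3
  exact log_ofReal_lt_coe_iff.2 (by linarith [(abs_lt.1 h3).2])

end Functional

/-! ### Elementary properties of singular values -/

section SingularValue

variable {𝕜 H : Type*} [RCLike 𝕜] [NormedAddCommGroup H] [InnerProductSpace 𝕜 H]

theorem exists_mem_norm_eq_one {V : Submodule 𝕜 H} (hV : 0 < Module.finrank 𝕜 V) :
    ∃ x ∈ V, ‖x‖ = 1 := by
  have := Module.nontrivial_of_finrank_pos hV
  obtain ⟨x, hx⟩ := exists_ne (0 : V)
  have hx' : ‖(x : H)‖ ≠ 0 := by simpa using hx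
  refine ⟨((‖(x : H)‖⁻¹ : ℝ) : 𝕜) • (x : H), V.smul_mem _ x.2, ?_⟩
  rw [norm_smul, RCLike.norm_ofReal, abs_inv, abs_norm, inv_mul_cancel₀ hx']

theorem exists_submodule_le_finrank_eq {V : Submodule 𝕜 H} {k : ℕ}
    (hk : k ≤ Module.finrank 𝕜 V) : ∃ W ≤ V, Module.finrank 𝕜 W = k := by
  obtain ⟨f, hf⟩ := exists_linearIndependent_of_le_finrank hk
  refine ⟨Submodule.span 𝕜 (range fun i => (f i : H)), ?_, ?_⟩
  · rw [Submodule.span_le]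
    rintro _ ⟨i, rfl⟩
    exact (f i).2
  · have h : LinearIndependent 𝕜 fun i => (f i : H) := hf.map' V.subtype V.ker_subtype
    rw [finrank_span_eq_card h, Fintype.card_fin]

/-- `inf {‖L x‖ : x ∈ V, ‖x‖ = 1}`. -/
noncomputable def lowerNorm (L : H →L[𝕜] H) (V : Submodule 𝕜 H) : ℝ :=
  sInf {s : ℝ | ∃ x ∈ V, ‖x‖ = 1 ∧ s = ‖L x‖}

theorem lowerNorm_nonneg (L : H →L[𝕜] H) (V : Submodule 𝕜 H) : 0 ≤ lowerNorm L V := by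
  refine Real.sInf_nonneg ?_
  rintro _ ⟨x, -, -, rfl⟩
  exact norm_nonneg _

theorem lowerNorm_le (L : H →L[𝕜] H) {V : Submodule 𝕜 H} {x : H} (hx : x ∈ V) (h1 : ‖x‖ = 1) :
    lowerNorm L V ≤ ‖L x‖ :=
  csInf_le ⟨0, by rintro _ ⟨x, -, -, rfl⟩; exact norm_nonneg _⟩ ⟨x, hx, h1, rfl⟩

theorem le_lowerNorm (L : H →L[𝕜] H) {V : Submodule 𝕜 H} (hV : 0 < Module.finrank 𝕜 V) {c : ℝ}
    (h : ∀ x ∈ V, ‖x‖ = 1 → c ≤ ‖L x‖) : c ≤ lowerNorm L V := by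
  obtain ⟨x, hx, h1⟩ := exists_mem_norm_eq_one hV
  refine le_csInf ⟨_, x, hx, h1, rfl⟩ ?_
  rintro _ ⟨y, hy, hy1, rfl⟩
  exact h y hy hy1

theorem singularValue_nonneg (L : H →L[𝕜] H) (k : ℕ) : 0 ≤ singularValue L k := by
  refine Real.sSup_nonneg ?_
  rintro _ ⟨V, -, rfl⟩
  exact lowerNorm_nonneg L V

theorem lowerNorm_le_norm (L : H →L[𝕜] H) {V : Submodule 𝕜 H} (hV : 0 < Module.finrank 𝕜 V) :
    lowerNorm L V ≤ ‖L‖ := by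
  obtain ⟨x, hx, h1⟩ := exists_mem_norm_eq_one hV
  refine (lowerNorm_le L hx h1).trans ((L.le_opNorm x).trans ?_)
  rw [h1, mul_one]

theorem lowerNorm_le_singularValue (L : H →L[𝕜] H) {V : Submodule 𝕜 H}
    (hV : 0 < Module.finrank 𝕜 V) : lowerNorm L V ≤ singularValue L (Module.finrank 𝕜 V) := by
  refine le_csSup ⟨‖L‖, ?_⟩ ⟨V, rfl, rfl⟩
  rintro _ ⟨W, hW, rfl⟩
  exact lowerNorm_le_norm L (hW ▸ hV)

theorem singularValue_le_of_forall {L : H →L[𝕜] H} {k : ℕ} {c : ℝ} (hc : 0 ≤ c)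
    (h : ∀ V : Submodule 𝕜 H, Module.finrank 𝕜 V = k → lowerNorm L V ≤ c) :
    singularValue L k ≤ c := by
  refine Real.sSup_le ?_ hc
  rintro _ ⟨V, hV, rfl⟩
  exact h V hV

theorem singularValue_le_norm (L : H →L[𝕜] H) {k : ℕ} (hk : 0 < k) : singularValue L k ≤ ‖L‖ :=
  singularValue_le_of_forall (norm_nonneg _) fun _ hV => lowerNorm_le_norm L (hV ▸ hk)

theorem singularValue_succ_le (L : H →L[𝕜] H) {k : ℕ} (hk : 0 < k) :
    singularValue L (k + 1) ≤ singularValue L k := by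
  refine singularValue_le_of_forall (singularValue_nonneg _ _) fun V hV => ?_
  obtain ⟨W, hWV, hW⟩ := exists_submodule_le_finrank_eq (V := V) (k := k) (by omega)
  rw [← hW]
  refine le_trans ?_ (lowerNorm_le_singularValue L (hW ▸ hk))
  exact le_lowerNorm L (hW ▸ hk) fun x hx h1 => lowerNorm_le L (hWV hx) h1

theorem singularValue_anti (L : H →L[𝕜] H) {j k : ℕ} (hj : 0 < j) (hjk : j ≤ k) :
    singularValue L k ≤ singularValue L j := by
  induction k, hjk using Nat.le_induction with
  | base => exact le_rfl
  | succ k hjk ih => exact (singularValue_succ_le L (by omega)).trans ih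

/-- A competitor `V` for `L` is also one for `L'`, and its lower norm drops by at most `‖L - L'‖`.
-/
theorem singularValue_le_add_norm_sub (L L' : H →L[𝕜] H) {k : ℕ} (hk : 0 < k) :
    singularValue L k ≤ singularValue L' k + ‖L - L'‖ := by
  refine singularValue_le_of_forall
    (add_nonneg (singularValue_nonneg _ _) (norm_nonneg _)) fun V hV => ?_
  have hV' : 0 < Module.finrank 𝕜 V := hV ▸ hk
  rw [← sub_le_iff_le_add, ← hV]
  refine le_trans (le_lowerNorm L' hV' fun x hx h1 => ?_) (lowerNorm_le_singularValue L' hV')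
  have h2 := (L - L').le_opNorm x
  rw [h1, mul_one, sub_apply] at h2
  have := norm_le_norm_add_norm_sub' (L x) (L' x)
  linarith [lowerNorm_le L hx h1]

theorem abs_singularValue_sub_le (L L' : H →L[𝕜] H) {k : ℕ} (hk : 0 < k) :
    |singularValue L k - singularValue L' k| ≤ ‖L - L'‖ := by
  have h1 := singularValue_le_add_norm_sub L L' hk
  have h2 := singularValue_le_add_norm_sub L' L hk
  rw [norm_sub_rev] at h2
  rw [abs_le]
  constructor <;> linarith

end SingularValue

/-! ### Singular value decomposition on finite-dimensional subspaces -/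

section SingularBasis

variable {𝕜 H : Type*} [RCLike 𝕜] [NormedAddCommGroup H] [InnerProductSpace 𝕜 H]

/-- An orthonormal basis of `V` with orthogonal images under `L`, of decreasing norms. -/
structure IsSingularBasis (L : H →L[𝕜] H) {V : Submodule 𝕜 H} {n : ℕ}
    (e : OrthonormalBasis (Fin n) 𝕜 V) : Prop where
  inner_eq_zero : ∀ i j, i ≠ j → inner 𝕜 (L (e i)) (L (e j)) = 0
  antitone : Antitone fun i => ‖L (e i)‖

/-- The basis consists of eigenvectors of `S* S`, where `S` is the restriction of `L` to `V`; finite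
dimension of `V` replaces compactness of `L`. -/
theorem exists_isSingularBasis [CompleteSpace H] (L : H →L[𝕜] H) (V : Submodule 𝕜 H)
    [FiniteDimensional 𝕜 V] :
    ∃ e : OrthonormalBasis (Fin (Module.finrank 𝕜 V)) 𝕜 V, IsSingularBasis L e := by
  have : CompleteSpace V := FiniteDimensional.complete 𝕜 V
  set S : V →L[𝕜] H := L.comp V.subtypeL
  set R : V →ₗ[𝕜] V := ((S.adjoint.comp S : V →L[𝕜] V) : V →ₗ[𝕜] V)
  have hR : ∀ x y, inner 𝕜 (R x) y = inner 𝕜 (S x) (S y) := fun x y =>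
    ContinuousLinearMap.adjoint_inner_left S y (S x)
  have hR' : ∀ x y, inner 𝕜 x (R y) = inner 𝕜 (S x) (S y) := fun x y =>
    ContinuousLinearMap.adjoint_inner_right S x (S y)
  have hsymm : R.IsSymmetric := fun x y => (hR x y).trans (hR' x y).symm
  set e := hsymm.eigenvectorBasis rfl
  have hval : ∀ i j, inner 𝕜 (S (e i)) (S (e j)) =
      (hsymm.eigenvalues rfl j : 𝕜) * inner 𝕜 (e i) (e j) := by
    intro i j
    rw [← hR', hsymm.apply_eigenvectorBasis, inner_smul_right]
  refine ⟨e, fun i j hij => ?_, fun i j hij => ?_⟩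
  · change inner 𝕜 (S (e i)) (S (e j)) = 0
    rw [hval, e.inner_eq_zero hij, mul_zero]
  · change ‖S (e j)‖ ≤ ‖S (e i)‖
    have hsq : ∀ i, ‖S (e i)‖ ^ 2 = hsymm.eigenvalues rfl i := by
      intro i
      have := hval i i
      rw [inner_self_eq_norm_sq_to_K, inner_self_eq_norm_sq_to_K, e.norm_eq_one] at this
      simp only [RCLike.ofReal_one, one_pow, mul_one] at this
      exact_mod_cast this
    refine le_of_sq_le_sq ?_ (norm_nonneg _)
    rw [hsq, hsq]
    exact hsymm.eigenvalues_antitone rfl hij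

theorem norm_sum_smul_sq {n : ℕ} {v : Fin n → H} (hv : ∀ i j, i ≠ j → inner 𝕜 (v i) (v j) = 0)
    (c : Fin n → 𝕜) : ‖∑ i, c i • v i‖ ^ 2 = ∑ i, ‖c i‖ ^ 2 * ‖v i‖ ^ 2 := by
  have h : (‖∑ i, c i • v i‖ ^ 2 : 𝕜) = ∑ i, (‖c i‖ ^ 2 * ‖v i‖ ^ 2 : 𝕜) := by
    rw [← inner_self_eq_norm_sq_to_K, sum_inner]
    refine Finset.sum_congr rfl fun i _ => ?_
    rw [inner_sum, Finset.sum_eq_single i]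
    · rw [inner_smul_left, inner_smul_right, inner_self_eq_norm_sq_to_K, ← mul_assoc,
        RCLike.conj_mul]
    · intro j _ hj
      rw [inner_smul_left, inner_smul_right, hv i j hj.symm, mul_zero, mul_zero]
    · simp
  exact_mod_cast h

variable {L : H →L[𝕜] H} {V : Submodule 𝕜 H} {n : ℕ} {e : OrthonormalBasis (Fin n) 𝕜 V}

theorem IsSingularBasis.norm_apply_sq (he : IsSingularBasis L e) (x : V) :
    ‖L x‖ ^ 2 = ∑ i, ‖e.repr x i‖ ^ 2 * ‖L (e i)‖ ^ 2 := by
  rw [← norm_sum_smul_sq he.inner_eq_zero]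
  congr 2
  conv_lhs => rw [← e.sum_repr x]
  simp

theorem sum_norm_repr_sq (e : OrthonormalBasis (Fin n) 𝕜 V) (x : V) :
    ∑ i, ‖e.repr x i‖ ^ 2 = ‖(x : H)‖ ^ 2 := by
  rw [← EuclideanSpace.norm_sq_eq, LinearIsometryEquiv.norm_map]
  rfl

/-- The trial subspace is the span of `e 0, …, e k`, of dimension `k + 1`: on it `L` stretches every
vector by at least `‖L (e k)‖`. -/
theorem IsSingularBasis.norm_apply_le_singularValue (he : IsSingularBasis L e) (k : Fin n) :
    ‖L (e k)‖ ≤ singularValue L (k + 1) := by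
  set g : Fin (k + 1) → V := fun i => e (Fin.castLE k.2 i)
  set W : Submodule 𝕜 H := Submodule.span 𝕜 (range fun i => (g i : H))
  have hli : LinearIndependent 𝕜 g :=
    e.orthonormal.linearIndependent.comp _ (Fin.castLE_injective k.2)
  have hW : Module.finrank 𝕜 W = k + 1 := by
    have h : LinearIndependent 𝕜 fun i => (g i : H) := hli.map' V.subtype V.ker_subtype
    rw [finrank_span_eq_card h, Fintype.card_fin]
  have hW' : 0 < Module.finrank 𝕜 W := by omega
  rw [← hW]
  refine le_trans (le_lowerNorm L hW' ?_) (lowerNorm_le_singularValue L hW')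
  intro x hx h1
  have hWeq : W = (Submodule.span 𝕜 (range g)).map V.subtype := by
    rw [Submodule.map_span, ← range_comp]
    rfl
  rw [hWeq] at hx
  obtain ⟨y, hy, rfl⟩ := hx
  have hzero : ∀ i, k < i → e.repr y i = 0 := by
    intro i hi
    rw [e.repr_apply_apply]
    clear h1
    induction hy using Submodule.span_induction with
    | mem x hx =>
      obtain ⟨j, rfl⟩ := hx
      refine e.inner_eq_zero fun h => ?_
      have := congrArg Fin.val h
      simp only [Fin.val_castLE] at this
      have := j.2
      have : (k : ℕ) < i := hi
      omega
    | zero => exact inner_zero_right _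
    | add x y _ _ hx hy => rw [inner_add_right, hx, hy, add_zero]
    | smul a x _ hx => rw [inner_smul_right, hx, mul_zero]
  refine le_of_sq_le_sq ?_ (norm_nonneg _)
  change _ ≤ ‖L y‖ ^ 2
  rw [he.norm_apply_sq y]
  have h1' : ‖(y : H)‖ = 1 := h1
  calc ‖L (e k)‖ ^ 2 = ∑ i, ‖e.repr y i‖ ^ 2 * ‖L (e k)‖ ^ 2 := by
        rw [← Finset.sum_mul, sum_norm_repr_sq, h1', one_pow, one_mul]
    _ ≤ _ := by
        refine Finset.sum_le_sum fun i _ => ?_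
        rcases lt_or_ge k i with hki | hik
        · simp [hzero i hki]
        · have := he.antitone hik
          gcongr

/-- The Courant–Fischer dimension count: `W` contains a nonzero vector orthogonal to the first `k`
basis vectors, and there `L` stretches by at most `‖L (e k)‖`. -/
theorem IsSingularBasis.lowerNorm_le (he : IsSingularBasis L e) (k : Fin n) {W : Submodule 𝕜 H}
    (hWV : W ≤ V) (hW : Module.finrank 𝕜 W = k + 1) : lowerNorm L W ≤ ‖L (e k)‖ := by
  have : FiniteDimensional 𝕜 W := FiniteDimensional.of_finrank_pos (by omega)
  set F : W →ₗ[𝕜] (Fin k → 𝕜) :=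
    LinearMap.pi fun i => (innerSL 𝕜 (e (Fin.castLT i (i.2.trans k.2)))).toLinearMap ∘ₗ
      Submodule.inclusion hWV
  obtain ⟨x, hxF, hx0⟩ := Submodule.exists_mem_ne_zero_of_ne_bot
    (LinearMap.ker_ne_bot_of_finrank_lt (f := F) (by simp [hW]))
  set y : V := Submodule.inclusion hWV x
  have hzero : ∀ i, i < k → e.repr y i = 0 := by
    intro i hi
    have := congrFun (LinearMap.mem_ker.1 hxF) ⟨i, hi⟩
    rw [e.repr_apply_apply]
    exact this
  have hyx : (y : H) = x := rfl
  have hle : ‖L y‖ ^ 2 ≤ ‖(y : H)‖ ^ 2 * ‖L (e k)‖ ^ 2 := by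
    rw [he.norm_apply_sq y, ← sum_norm_repr_sq e y, Finset.sum_mul]
    refine Finset.sum_le_sum fun i _ => ?_
    rcases lt_or_ge i k with hik | hki
    · simp [hzero i hik]
    · have := he.antitone hki
      gcongr
  have hle' : ‖L x‖ ≤ ‖(x : H)‖ * ‖L (e k)‖ := by
    rw [← mul_pow] at hle
    exact le_of_sq_le_sq hle (by positivity)
  have hx' : 0 < ‖(x : H)‖ := by simpa using hx0
  refine (UniformLyapunov.lowerNorm_le L (W.smul_mem ((‖(x : H)‖⁻¹ : ℝ) : 𝕜) x.2) ?_).trans ?_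
  · rw [norm_smul, RCLike.norm_ofReal, abs_inv, abs_norm, inv_mul_cancel₀ hx'.ne']
  · rw [map_smul, norm_smul, RCLike.norm_ofReal, abs_inv, abs_norm, inv_mul_le_iff₀ hx']
    exact hle'

end SingularBasis

/-! ### The norm of the exterior powers -/

section Wedge

variable {𝕜 H : Type*} [RCLike 𝕜] [NormedAddCommGroup H] [InnerProductSpace 𝕜 H] {m : ℕ}

theorem wedgeInner_sum_sum {ι : Type*} [Fintype ι] (u : ι → ⋀[𝕜]^m H) (a : ι → 𝕜)
    (hu : ∀ i j, i ≠ j → wedgeInner (u i) (u j) = 0) :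
    wedgeInner (∑ i, a i • u i) (∑ i, a i • u i) =
      ∑ i, ((‖a i‖ ^ 2 : ℝ) : 𝕜) * wedgeInner (u i) (u i) := by
  have h : wedgeInner (∑ i, a i • u i) (∑ i, a i • u i) =
      ∑ i, ∑ j, starRingEnd 𝕜 (a i) * a j * wedgeInner (u i) (u j) := by
    simp only [wedgeInner, map_sum, LinearMap.sum_apply, map_smul, LinearMap.smul_apply,
      LinearMap.map_smulₛₗ, Finset.mul_sum, smul_eq_mul]
    refine Finset.sum_congr rfl fun i _ => Finset.sum_congr rfl fun j _ => ?_
    ring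
  rw [h]
  refine Finset.sum_congr rfl fun i _ => ?_
  rw [Finset.sum_eq_single i]
  · rw [RCLike.conj_mul]
    push_cast
    rfl
  · intro j _ hji
    rw [hu i j hji.symm, mul_zero]
  · simp

theorem wedgeInner_ιMulti_self {v : Fin m → H} (hv : ∀ i j, i ≠ j → inner 𝕜 (v i) (v j) = 0) :
    wedgeInner (exteriorPower.ιMulti 𝕜 m v) (exteriorPower.ιMulti 𝕜 m v) =
      (((m.factorial : ℝ)⁻¹ * ∏ i, ‖v i‖ ^ 2 : ℝ) : 𝕜) := by
  rw [wedgeInner_ιMulti]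
  have : (Matrix.of fun j k => inner 𝕜 (v j) (v k)) =
      Matrix.diagonal fun i => (‖v i‖ ^ 2 : 𝕜) := by
    ext j k
    by_cases h : j = k
    · subst h
      simp [inner_self_eq_norm_sq_to_K]
    · simp [h, hv j k h]
  rw [this, Matrix.det_diagonal]
  push_cast
  rfl

theorem wedgeNorm_ιMulti_sq {v : Fin m → H} (hv : ∀ i j, i ≠ j → inner 𝕜 (v i) (v j) = 0) :
    wedgeNorm (exteriorPower.ιMulti 𝕜 m v) ^ 2 = (m.factorial : ℝ)⁻¹ * ∏ i, ‖v i‖ ^ 2 := by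
  rw [wedgeNorm, wedgeInner_ιMulti_self hv, RCLike.ofReal_re, Real.sq_sqrt (by positivity)]

/-- Some index in `I` is missing from `J`, so the Gram matrix has a zero row. -/
theorem wedgeInner_ιMulti_family_eq_zero {n : ℕ} {v : Fin n → H}
    (hv : ∀ i j, i ≠ j → inner 𝕜 (v i) (v j) = 0) {I J : Set.powersetCard (Fin n) m}
    (hIJ : I ≠ J) :
    wedgeInner (exteriorPower.ιMulti_family 𝕜 m v I) (exteriorPower.ιMulti_family 𝕜 m v J) =
      0 := by
  rw [exteriorPower.ιMulti_family, exteriorPower.ιMulti_family, wedgeInner_ιMulti]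
  obtain ⟨i, hi⟩ : ∃ i, Set.powersetCard.ofFinEmbEquiv.symm I i ∉
      range (Set.powersetCard.ofFinEmbEquiv.symm J) := by
    obtain ⟨i, hiI, hiJ⟩ := (Set.powersetCard.exists_mem_notMem_iff_ne I J).mp hIJ
    obtain ⟨k, rfl⟩ := (Set.powersetCard.mem_range_ofFinEmbEquiv_symm_iff_mem I i).mpr hiI
    exact ⟨k, fun h => hiJ ((Set.powersetCard.mem_range_ofFinEmbEquiv_symm_iff_mem J _).mp h)⟩
  rw [Matrix.det_eq_zero_of_row_eq_zero i, mul_zero]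
  intro k
  exact hv _ _ fun h => hi ⟨k, h.symm⟩

theorem wedgeNorm_sum_sq {n : ℕ} {v : Fin n → H}
    (hv : ∀ i j, i ≠ j → inner 𝕜 (v i) (v j) = 0) (a : Set.powersetCard (Fin n) m → 𝕜) :
    wedgeNorm (∑ I, a I • exteriorPower.ιMulti_family 𝕜 m v I) ^ 2 =
      ∑ I, ‖a I‖ ^ 2 * ((m.factorial : ℝ)⁻¹ *
        ∏ i, ‖v (Set.powersetCard.ofFinEmbEquiv.symm I i)‖ ^ 2) := by
  rw [wedgeNorm, wedgeInner_sum_sum _ _ fun I J h => wedgeInner_ιMulti_family_eq_zero hv h]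
  have h : ∀ I, wedgeInner (exteriorPower.ιMulti_family 𝕜 m v I)
      (exteriorPower.ιMulti_family 𝕜 m v I) = (((m.factorial : ℝ)⁻¹ *
        ∏ i, ‖v (Set.powersetCard.ofFinEmbEquiv.symm I i)‖ ^ 2 : ℝ) : 𝕜) := fun I =>
    wedgeInner_ιMulti_self fun i j hij => hv _ _ fun h =>
      hij ((Set.powersetCard.ofFinEmbEquiv.symm I).injective h)
  simp only [h]
  rw [← Finset.sum_congr rfl fun I _ => RCLike.ofReal_mul _ _, ← RCLike.ofReal_sum,
    RCLike.ofReal_re, Real.sq_sqrt (by positivity)]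

/-- Every element of an exterior power comes from a finite-dimensional subspace. -/
theorem exists_finiteDimensional_map_eq (x : ⋀[𝕜]^m H) :
    ∃ V : Submodule 𝕜 H, FiniteDimensional 𝕜 V ∧
      ∃ y : ⋀[𝕜]^m V, exteriorPower.map m V.subtype y = x := by
  have hx : x ∈ Submodule.span 𝕜 (range (exteriorPower.ιMulti 𝕜 m (M := H))) := by
    rw [exteriorPower.ιMulti_span]
    trivial
  have hmono : ∀ {V W : Submodule 𝕜 H} (h : V ≤ W) (y : ⋀[𝕜]^m V),
      exteriorPower.map m W.subtype (exteriorPower.map m (Submodule.inclusion h) y) =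
        exteriorPower.map m V.subtype y := by
    intro V W h y
    rw [← LinearMap.comp_apply, ← exteriorPower.map_comp, Submodule.subtype_comp_inclusion]
  induction hx using Submodule.span_induction with
  | mem x hx =>
    obtain ⟨v, rfl⟩ := hx
    refine ⟨Submodule.span 𝕜 (range v), FiniteDimensional.span_of_finite 𝕜 (finite_range v),
      exteriorPower.ιMulti 𝕜 m fun i => ⟨v i, Submodule.subset_span ⟨i, rfl⟩⟩, ?_⟩
    rw [exteriorPower.map_apply_ιMulti]
    rfl
  | zero => exact ⟨⊥, inferInstance, 0, map_zero _⟩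
  | add x y _ _ hx hy =>
    obtain ⟨V, hV, x, rfl⟩ := hx
    obtain ⟨W, hW, y, rfl⟩ := hy
    refine ⟨V ⊔ W, inferInstance, exteriorPower.map m (Submodule.inclusion le_sup_left) x +
      exteriorPower.map m (Submodule.inclusion le_sup_right) y, ?_⟩
    rw [map_add, hmono, hmono]
  | smul a x _ hx =>
    obtain ⟨V, hV, x, rfl⟩ := hx
    exact ⟨V, hV, a • x, map_smul _ _ _⟩

theorem prod_Icc_singularValue (L : H →L[𝕜] H) (m : ℕ) :
    ∏ j ∈ Finset.Icc 1 m, singularValue L j = ∏ i : Fin m, singularValue L (i + 1) := by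
  induction m with
  | zero => simp
  | succ m ih => rw [Finset.prod_Icc_succ_top (by omega), ih, Fin.prod_univ_castSucc]; simp

theorem prod_Icc_singularValue_nonneg (L : H →L[𝕜] H) (m : ℕ) :
    0 ≤ ∏ j ∈ Finset.Icc 1 m, singularValue L j :=
  Finset.prod_nonneg fun _ _ => singularValue_nonneg _ _

theorem wedgeNorm_nonneg (x : ⋀[𝕜]^m H) : 0 ≤ wedgeNorm x := Real.sqrt_nonneg _

theorem val_le_orderEmbedding_val {n : ℕ} (φ : Fin m ↪o Fin n) (i : Fin m) :
    (i : ℕ) ≤ φ i := by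
  obtain ⟨i, hi⟩ := i
  induction i with
  | zero => exact Nat.zero_le _
  | succ i ih =>
    exact (ih (by omega)).trans_lt (φ.lt_iff_lt.2 (Fin.mk_lt_mk.2 i.lt_succ_self))

/-- Wedge products of a singular basis are orthogonal and have orthogonal images, so the bound can
be checked on each of them. If `φ` enumerates the chosen indices increasingly, then `i ≤ φ i`, and
the stretching factor `∏ ‖L (e (φ i))‖` is at most `∏ σ_{i+1}`. -/
theorem wedgeNorm_map_le [CompleteSpace H] (L : H →L[𝕜] H) (x : ⋀[𝕜]^m H) :
    wedgeNorm (exteriorPower.map m (L : H →ₗ[𝕜] H) x) ≤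
      (∏ j ∈ Finset.Icc 1 m, singularValue L j) * wedgeNorm x := by
  obtain ⟨V, hV, y, rfl⟩ := exists_finiteDimensional_map_eq x
  obtain ⟨e, he⟩ := exists_isSingularBasis L V
  set a := (e.toBasis.exteriorPower m).repr y
  have hy : y = ∑ I, a I • exteriorPower.ιMulti_family 𝕜 m e I := by
    conv_lhs => rw [← (e.toBasis.exteriorPower m).sum_repr y]
    simp [a, exteriorPower.basis_apply]
  have hx : exteriorPower.map m V.subtype y =
      ∑ I, a I • exteriorPower.ιMulti_family 𝕜 m (fun i => (e i : H)) I := by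
    conv_lhs => rw [hy]
    simp only [map_sum, map_smul, exteriorPower.map_apply_ιMulti_family]
    rfl
  have hLx : exteriorPower.map m (L : H →ₗ[𝕜] H) (exteriorPower.map m V.subtype y) =
      ∑ I, a I • exteriorPower.ιMulti_family 𝕜 m (fun i => L (e i)) I := by
    rw [hx]
    simp only [map_sum, map_smul, exteriorPower.map_apply_ιMulti_family]
    rfl
  have horth : ∀ i j, i ≠ j → inner 𝕜 (e i : H) (e j : H) = 0 := fun i j h => e.inner_eq_zero h
  refine le_of_sq_le_sq ?_ (mul_nonneg (prod_Icc_singularValue_nonneg L m) (wedgeNorm_nonneg _))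
  rw [mul_pow, hLx, hx, wedgeNorm_sum_sq he.inner_eq_zero, wedgeNorm_sum_sq horth,
    Finset.mul_sum]
  refine Finset.sum_le_sum fun I _ => ?_
  set φ := Set.powersetCard.ofFinEmbEquiv.symm I
  have h1 : ∏ i, ‖(e (φ i) : H)‖ ^ 2 = 1 :=
    Finset.prod_eq_one fun i _ => by
      rw [show ‖(e (φ i) : H)‖ = 1 from e.norm_eq_one _, one_pow]
  have h2 : ∏ i, ‖L (e (φ i))‖ ^ 2 ≤ (∏ j ∈ Finset.Icc 1 m, singularValue L j) ^ 2 := by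
    rw [prod_Icc_singularValue, ← Finset.prod_pow]
    refine Finset.prod_le_prod (fun i _ => by positivity) fun i _ => ?_
    refine pow_le_pow_left₀ (norm_nonneg _) ?_ 2
    refine (he.norm_apply_le_singularValue (φ i)).trans (singularValue_anti L (by omega) ?_)
    have := val_le_orderEmbedding_val φ i
    omega
  rw [h1, mul_one]
  calc _ = (‖a I‖ ^ 2 * (m.factorial : ℝ)⁻¹) * ∏ i, ‖L (e (φ i))‖ ^ 2 := by ring
    _ ≤ (‖a I‖ ^ 2 * (m.factorial : ℝ)⁻¹) * (∏ j ∈ Finset.Icc 1 m, singularValue L j) ^ 2 := by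
      gcongr
    _ = _ := by ring

theorem exists_lt_lowerNorm {L : H →L[𝕜] H} {k : ℕ} {r : ℝ} (hr0 : 0 ≤ r)
    (hr : r < singularValue L k) :
    ∃ V : Submodule 𝕜 H, Module.finrank 𝕜 V = k ∧ r < lowerNorm L V := by
  by_contra! h
  exact hr.not_ge (singularValue_le_of_forall hr0 h)

/-- The suprema defining `σ_j` need not be attained, and near-optimal subspaces for different `j`
may be unrelated. All of them lie in their sum `W`, whose singular basis does at least as well as
each. Testing the bound on the wedge of its first `m` vectors loses only a factor `a ^ m`, with `a →
1`. -/
theorem prod_singularValue_le_of_bound [CompleteSpace H] (L : H →L[𝕜] H) {c : ℝ}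
    (hc0 : 0 ≤ c) (hc : ∀ x : ⋀[𝕜]^m H,
      wedgeNorm (exteriorPower.map m (L : H →ₗ[𝕜] H) x) ≤ c * wedgeNorm x) :
    ∏ j ∈ Finset.Icc 1 m, singularValue L j ≤ c := by
  rw [prod_Icc_singularValue]
  -- Positivity is needed for the strict inequality `a * σ < σ`; a vanishing singular value makes
  -- the product zero.
  by_cases hpos : ∀ i : Fin m, 0 < singularValue L (i + 1)
  swap
  · push Not at hpos
    obtain ⟨i, hi⟩ := hpos
    rw [Finset.prod_eq_zero (Finset.mem_univ i) (hi.antisymm (singularValue_nonneg _ _))]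
    exact hc0
  have key : ∀ a : ℝ, 0 < a → a < 1 → a ^ m * ∏ i : Fin m, singularValue L (i + 1) ≤ c := by
    intro a ha0 ha1
    choose V hV hlow using fun i : Fin m => exists_lt_lowerNorm (L := L) (k := i + 1)
      (mul_nonneg ha0.le (singularValue_nonneg _ _)) (mul_lt_of_lt_one_left (hpos i) ha1)
    have hfin : ∀ i, FiniteDimensional 𝕜 (V i) := fun i =>
      FiniteDimensional.of_finrank_pos (by rw [hV]; omega)
    set W := ⨆ i, V i
    have hVW : ∀ i, V i ≤ W := le_iSup V
    obtain ⟨e, he⟩ := exists_isSingularBasis L W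
    have hmn : m ≤ Module.finrank 𝕜 W := by
      rcases m with _ | m
      · exact Nat.zero_le _
      · have := Submodule.finrank_mono (hVW (Fin.last m))
        rwa [hV, Fin.val_last] at this
    set v : Fin m → W := fun i => e (Fin.castLE hmn i)
    have hlow' : ∀ i : Fin m, a * singularValue L (i + 1) ≤ ‖L (v i)‖ := fun i =>
      (hlow i).le.trans (he.lowerNorm_le (Fin.castLE hmn i) (hVW i) (hV i))
    have hx := hc (exteriorPower.ιMulti 𝕜 m fun i => (v i : H))
    rw [exteriorPower.map_apply_ιMulti] at hx
    have hinj := Fin.castLE_injective hmn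
    have h1 := wedgeNorm_ιMulti_sq (𝕜 := 𝕜) (v := fun i => (v i : H))
      fun i j h => e.inner_eq_zero fun h' => h (hinj h')
    have h2 := wedgeNorm_ιMulti_sq (𝕜 := 𝕜) (v := fun i => L (v i))
      fun i j h => he.inner_eq_zero _ _ fun h' => h (hinj h')
    have h3 : ∀ i, ‖(v i : H)‖ = 1 := fun i => e.norm_eq_one _
    simp only [h3, one_pow, Finset.prod_const_one, mul_one] at h1
    have hfact : (0 : ℝ) < (m.factorial : ℝ)⁻¹ := by positivity
    have h4 := pow_le_pow_left₀ (wedgeNorm_nonneg _) hx 2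
    rw [mul_pow, h1, mul_comm] at h4
    have h5 : ∏ i, ‖L (v i)‖ ≤ c := by
      refine le_of_sq_le_sq (le_of_mul_le_mul_left ?_ hfact) hc0
      rw [← Finset.prod_pow, ← h2]
      exact h4
    refine le_trans ?_ h5
    rw [show a ^ m = ∏ _i : Fin m, a by simp, ← Finset.prod_mul_distrib]
    exact Finset.prod_le_prod
      (fun i _ => mul_nonneg ha0.le (singularValue_nonneg _ _)) fun i _ => hlow' i
  have hlim : Tendsto (fun a : ℝ => a ^ m * ∏ i : Fin m, singularValue L (i + 1)) (𝓝[<] 1)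
      (𝓝 (1 ^ m * ∏ i : Fin m, singularValue L (i + 1))) :=
    ((continuous_id.pow m).mul continuous_const).continuousWithinAt
  rw [one_pow, one_mul] at hlim
  refine le_of_tendsto hlim ?_
  filter_upwards [Ioo_mem_nhdsLT (zero_lt_one (α := ℝ))] with a ha using key a ha.1 ha.2

theorem compoundNorm_eq_prod [CompleteSpace H] (m : ℕ) (L : H →L[𝕜] H) :
    compoundNorm m L = ∏ j ∈ Finset.Icc 1 m, singularValue L j := by
  have hmem : (∏ j ∈ Finset.Icc 1 m, singularValue L j) ∈ {c : ℝ | 0 ≤ c ∧ ∀ x : ⋀[𝕜]^m H,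
      wedgeNorm (exteriorPower.map m (L : H →ₗ[𝕜] H) x) ≤ c * wedgeNorm x} :=
    ⟨prod_Icc_singularValue_nonneg L m, wedgeNorm_map_le L⟩
  exact le_antisymm (csInf_le ⟨0, fun c hc => hc.1⟩ hmem)
    (le_csInf ⟨_, hmem⟩ fun c hc => prod_singularValue_le_of_bound L hc.1 hc.2)

/-- Horn's inequality. -/
theorem prod_singularValue_comp_le [CompleteSpace H] (m : ℕ) (L L' : H →L[𝕜] H) :
    ∏ j ∈ Finset.Icc 1 m, singularValue (L.comp L') j ≤
      (∏ j ∈ Finset.Icc 1 m, singularValue L j) * ∏ j ∈ Finset.Icc 1 m, singularValue L' j := by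
  refine prod_singularValue_le_of_bound _ (mul_nonneg (prod_Icc_singularValue_nonneg L m)
    (prod_Icc_singularValue_nonneg L' m)) fun x => ?_
  have : exteriorPower.map m ((L.comp L' : H →L[𝕜] H) : H →ₗ[𝕜] H) x =
      exteriorPower.map m (L : H →ₗ[𝕜] H) (exteriorPower.map m (L' : H →ₗ[𝕜] H) x) := by
    rw [← LinearMap.comp_apply, ← exteriorPower.map_comp]
    rfl
  rw [this, mul_assoc]
  exact (wedgeNorm_map_le L _).trans (mul_le_mul_of_nonneg_left (wedgeNorm_map_le L' x)
    (prod_Icc_singularValue_nonneg L m))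

end Wedge

/-! ### Functions of singular values of cocycles -/

section SingularFunction

variable {𝕜 H : Type*} [RCLike 𝕜] [NormedAddCommGroup H] [InnerProductSpace 𝕜 H]

theorem singularFunction_natCast (m : ℕ) (L : H →L[𝕜] H) :
    singularFunction m L = ∏ j ∈ Finset.Icc 1 m, singularValue L j := by
  simp [singularFunction]

theorem singularFunction_nonneg (d : ℝ) (L : H →L[𝕜] H) : 0 ≤ singularFunction d L :=
  mul_nonneg (prod_Icc_singularValue_nonneg L _) (Real.rpow_nonneg (singularValue_nonneg _ _) _)

/-- As a weighted geometric mean of the integer cases, `ω_{m+γ}` inherits Horn's inequality from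
them. -/
theorem singularFunction_add_eq_rpow_mul_rpow (m : ℕ) {γ : ℝ} (h0 : 0 ≤ γ) (h1 : γ ≤ 1)
    (L : H →L[𝕜] H) : singularFunction (m + γ) L =
      (∏ j ∈ Finset.Icc 1 m, singularValue L j) ^ (1 - γ) *
        (∏ j ∈ Finset.Icc 1 (m + 1), singularValue L j) ^ γ := by
  have hP := prod_Icc_singularValue_nonneg L m
  rw [singularFunction_add m h0 h1, Finset.prod_Icc_succ_top (by omega),
    Real.mul_rpow hP (singularValue_nonneg _ _), ← mul_assoc,
    ← Real.rpow_add_of_nonneg hP (sub_nonneg.2 h1) h0, sub_add_cancel, Real.rpow_one]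

theorem isSubmultiplicativeFunctional_singularFunction_add [CompleteSpace H] (m : ℕ) {γ : ℝ}
    (h0 : 0 ≤ γ) (h1 : γ ≤ 1) :
    IsSubmultiplicativeFunctional (𝕜 := 𝕜) (E := H) (singularFunction (m + γ)) where
  nonneg := singularFunction_nonneg _
  comp_le L L' := by
    simp only [singularFunction_add_eq_rpow_mul_rpow m h0 h1]
    rw [mul_mul_mul_comm,
      ← Real.mul_rpow (prod_Icc_singularValue_nonneg L _) (prod_Icc_singularValue_nonneg L' _),
      ← Real.mul_rpow (prod_Icc_singularValue_nonneg L _) (prod_Icc_singularValue_nonneg L' _)]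
    have h : ∀ k, 0 ≤ ∏ j ∈ Finset.Icc 1 k, singularValue (L.comp L') j :=
      prod_Icc_singularValue_nonneg _
    exact mul_le_mul
      (Real.rpow_le_rpow (h m) (prod_singularValue_comp_le m L L') (sub_nonneg.2 h1))
      (Real.rpow_le_rpow (h (m + 1)) (prod_singularValue_comp_le (m + 1) L L') h0)
      (Real.rpow_nonneg (h (m + 1)) _)
      (Real.rpow_nonneg ((h m).trans (prod_singularValue_comp_le m L L')) _)
  bounded C := by
    refine ⟨(∏ _j ∈ Finset.Icc 1 m, C) * C ^ γ, fun L hL => ?_⟩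
    have hC : 0 ≤ C := (norm_nonneg L).trans hL
    rw [singularFunction_add m h0 h1]
    refine mul_le_mul (Finset.prod_le_prod (fun j _ => singularValue_nonneg L j) fun j hj => ?_)
      (Real.rpow_le_rpow (singularValue_nonneg _ _)
        ((singularValue_le_norm L m.succ_pos).trans hL) h0)
      (Real.rpow_nonneg (singularValue_nonneg _ _) _) (Finset.prod_nonneg fun _ _ => hC)
    exact (singularValue_le_norm L (Finset.mem_Icc.1 hj).1).trans hL
  uniformContinuousOn C := by
    -- `ω_d` factors through the 1-Lipschitz map `σ`, which sends the ball into the compact cube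
    -- `[0, C]^{m+1}`; there the continuous function `G` is uniformly continuous.
    set σ : (H →L[𝕜] H) → (Fin (m + 1) → ℝ) := fun L i => singularValue L (i + 1)
    set G : (Fin (m + 1) → ℝ) → ℝ := fun s => (∏ i : Fin m, s i.castSucc) * s (Fin.last m) ^ γ
    have hσ : UniformContinuous σ := by
      refine uniformContinuous_pi.2 fun i => ?_
      refine (LipschitzWith.of_dist_le_mul (K := 1) fun L L' => ?_).uniformContinuous
      rw [Real.dist_eq, dist_eq_norm, NNReal.coe_one, one_mul]
      exact abs_singularValue_sub_le L L' (Nat.succ_pos _)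
    have hG : Continuous G := by
      have h2 : Continuous fun s : Fin (m + 1) → ℝ => ∏ i : Fin m, s i.castSucc :=
        continuous_finsetProd _ fun i _ => continuous_apply _
      have h3 : Continuous fun s : Fin (m + 1) → ℝ => s (Fin.last m) ^ γ :=
        (continuous_apply _).rpow_const fun _ => Or.inr h0
      exact h2.mul h3
    have hK : UniformContinuousOn G (univ.pi fun _ => Icc 0 C) :=
      (isCompact_univ_pi fun _ => isCompact_Icc).uniformContinuousOn_of_continuous
        hG.continuousOn
    have heq : singularFunction (𝕜 := 𝕜) (H := H) (m + γ) = G ∘ σ := by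
      ext L
      rw [singularFunction_add m h0 h1, prod_Icc_singularValue]
      rfl
    rw [heq]
    refine hK.comp hσ.uniformContinuousOn fun L hL i _ => ⟨singularValue_nonneg _ _, ?_⟩
    exact (singularValue_le_norm L (Nat.succ_pos _)).trans (mem_closedBall_zero_iff.1 hL)

theorem isSubmultiplicativeFunctional_singularFunction [CompleteSpace H] {d : ℝ} (hd : 0 ≤ d) :
    IsSubmultiplicativeFunctional (𝕜 := 𝕜) (E := H) (singularFunction d) := by
  have := isSubmultiplicativeFunctional_singularFunction_add (𝕜 := 𝕜) (H := H) ⌊d⌋₊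
    (sub_nonneg.2 (Nat.floor_le hd)) (by linarith [Nat.lt_floor_add_one d])
  rwa [add_sub_cancel] at this

variable {Q : Type*}

theorem meanSingularFunction_eq (d : ℝ) (Ξ : ℝ → Q → H →L[𝕜] H) (t : ℝ) :
    meanSingularFunction d Ξ t =
      EReal.exp (meanGrowth (logFamily (singularFunction d) Ξ) t) := by
  rw [meanGrowth_logFamily, meanSingularFunction, ENNReal.rpow_eq_exp_mul_log,
    EReal.div_eq_inv_mul, one_div, EReal.coe_inv]

theorem exp_limsup {α : Type*} (u : α → EReal) (l : Filter α) :
    EReal.exp (limsup u l) = limsup (fun a => EReal.exp (u a)) l :=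
  EReal.expOrderIso.limsup_apply

theorem averagedSingularFunction_eq (T : Set ℝ) (d : ℝ) (Ξ : ℝ → Q → H →L[𝕜] H) :
    averagedSingularFunction T d Ξ =
      EReal.exp (growthExponent T (logFamily (singularFunction d) Ξ)) := by
  rw [growthExponent, exp_limsup, averagedSingularFunction]
  congr 1
  ext t
  exact meanSingularFunction_eq d Ξ t

theorem meanLogCompoundNorm_eq [CompleteSpace H] (m : ℕ) (Ξ : ℝ → Q → H →L[𝕜] H) :
    meanLogCompoundNorm m Ξ = meanGrowth (logFamily (singularFunction m) Ξ) := by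
  ext t
  rw [meanGrowth_logFamily]
  simp only [meanLogCompoundNorm, compoundNorm_eq_prod, singularFunction_natCast]

theorem compoundExponent_eq [CompleteSpace H] (T : Set ℝ) (m : ℕ) (Ξ : ℝ → Q → H →L[𝕜] H) :
    compoundExponent T Ξ m = growthExponent T (logFamily (singularFunction m) Ξ) := by
  rw [compoundExponent, meanLogCompoundNorm_eq, growthExponent]

/-- `σ_{m+1}` is at most the geometric mean of `σ₁, …, σ_m`. -/
theorem prod_singularValue_succ_le_rpow (L : H →L[𝕜] H) {m : ℕ} (hm : 0 < m) :
    ∏ j ∈ Finset.Icc 1 (m + 1), singularValue L j ≤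
      (∏ j ∈ Finset.Icc 1 m, singularValue L j) ^ (1 + (m : ℝ)⁻¹) := by
  have hP := prod_Icc_singularValue_nonneg L m
  have hm' : (m : ℝ) ≠ 0 := by exact_mod_cast hm.ne'
  rw [Finset.prod_Icc_succ_top (by omega), Real.rpow_add_of_nonneg hP zero_le_one (by positivity),
    Real.rpow_one]
  refine mul_le_mul_of_nonneg_left ?_ hP
  have hpow : singularValue L (m + 1) ^ m ≤ ∏ j ∈ Finset.Icc 1 m, singularValue L j := by
    calc singularValue L (m + 1) ^ m = ∏ _j ∈ Finset.Icc 1 m, singularValue L (m + 1) := by simp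
      _ ≤ _ := Finset.prod_le_prod (fun _ _ => singularValue_nonneg _ _) fun j hj =>
        singularValue_anti L (Finset.mem_Icc.1 hj).1
          ((Finset.mem_Icc.1 hj).2.trans (Nat.le_succ m))
  calc singularValue L (m + 1) = (singularValue L (m + 1) ^ m) ^ (m : ℝ)⁻¹ :=
        (Real.pow_rpow_inv_natCast (singularValue_nonneg _ _) hm.ne').symm
    _ ≤ _ := Real.rpow_le_rpow (pow_nonneg (singularValue_nonneg _ _) _) hpow (by positivity)

/-- This makes a negative sum of exponents stay negative, and the value `-∞` persist, when further
exponents are added. -/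
theorem compoundExponent_succ_le [CompleteSpace H] {T : Set ℝ} (hT : IsTimeSet T)
    (Ξ : ℝ → Q → H →L[𝕜] H) {m : ℕ} (hm : 0 < m) :
    compoundExponent T Ξ (m + 1) ≤ ((1 + (m : ℝ)⁻¹ : ℝ) : EReal) * compoundExponent T Ξ m := by
  have := hT.timesAtTop_neBot
  have hc : 0 ≤ 1 + (m : ℝ)⁻¹ := by positivity
  rw [compoundExponent, compoundExponent, ← EReal.limsup_const_mul_of_nonneg_of_ne_top
    (EReal.coe_nonneg.2 hc) (EReal.coe_ne_top _)]
  refine limsup_le_limsup (eventually_timesAtTop 0 fun t _ ht => ?_)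
  simp only [meanLogCompoundNorm, EReal.mul_div]
  refine EReal.div_le_div_right_of_nonneg (EReal.coe_nonneg.2 ht) ?_
  rw [← ENNReal.log_rpow]
  refine ENNReal.log_le_log (iSup_le fun q => ?_)
  calc ENNReal.ofReal (compoundNorm (m + 1) (Ξ t q))
      ≤ ENNReal.ofReal (compoundNorm m (Ξ t q) ^ (1 + (m : ℝ)⁻¹)) := by
        rw [compoundNorm_eq_prod, compoundNorm_eq_prod]
        exact ENNReal.ofReal_le_ofReal (prod_singularValue_succ_le_rpow _ hm)
    _ = ENNReal.ofReal (compoundNorm m (Ξ t q)) ^ (1 + (m : ℝ)⁻¹) := by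
        rw [ENNReal.ofReal_rpow_of_nonneg _ hc]
        rw [compoundNorm_eq_prod]
        exact prod_Icc_singularValue_nonneg _ _
    _ ≤ _ := ENNReal.rpow_le_rpow
        (le_iSup (fun q => ENNReal.ofReal (compoundNorm m (Ξ t q))) q) hc

/-- A `d` with `ω̄_d < 1` at `ω₀` keeps this property for nearby `ω`, so it bounds their dimensions.
-/
theorem limsup_lyapunovDim_le {Ω : Type*} [TopologicalSpace Ω] {T : Set ℝ}
    {Ξ : Ω → ℝ → Q → H →L[𝕜] H} (ω₀ : Ω) (husc : ∀ d : ℝ, 0 ≤ d →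
      limsup (fun ω => averagedSingularFunction T d (Ξ ω)) (𝓝 ω₀) ≤
        averagedSingularFunction T d (Ξ ω₀)) :
    limsup (fun ω => lyapunovDim T (Ξ ω)) (𝓝 ω₀) ≤ lyapunovDim T (Ξ ω₀) := by
  refine le_sInf ?_
  rintro _ ⟨d, hd, h1, rfl⟩
  refine limsup_le_of_le (by isBoundedDefault) ?_
  filter_upwards [eventually_lt_of_limsup_lt ((husc d hd).trans_lt h1)] with ω hω
  exact sInf_le ⟨d, hd, hω, rfl⟩

theorem exponentSum_zero {T : Set ℝ} {Ξ : ℝ → Q → H →L[𝕜] H} : exponentSum T Ξ 0 = 0 := by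
  simp [exponentSum]

end SingularFunction

/-! ### The Kaplan–Yorke dimension -/

section KaplanYorke

variable {𝕜 H Q : Type*} [RCLike 𝕜] [NormedAddCommGroup H] [InnerProductSpace 𝕜 H]
  [CompleteSpace H] {T : Set ℝ} {Ξ : ℝ → Q → H →L[𝕜] H}

theorem compoundExponent_succ_eq_bot (hT : IsTimeSet T) {m : ℕ} (hm : 0 < m)
    (h : compoundExponent T Ξ m = ⊥) : compoundExponent T Ξ (m + 1) = ⊥ := by
  have := compoundExponent_succ_le hT Ξ hm
  rwa [h, EReal.coe_mul_bot_of_pos (by positivity), le_bot_iff] at this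

/-- Telescoping in `EReal` fails at `-∞`, but there the next compound exponent is `-∞` as well. The
index `0` is excluded: the empty sum is `0`, while `compoundExponent T Ξ 0` is `-∞` for empty `Q`.
-/
theorem exponentSum_succ (hT : IsTimeSet T) (htop : ∀ m, compoundExponent T Ξ m < ⊤) (m : ℕ) :
    exponentSum T Ξ (m + 1) = compoundExponent T Ξ (m + 1) := by
  induction m with
  | zero => simp [exponentSum, uniformExponent]
  | succ m ih =>
    have hsum : exponentSum T Ξ (m + 2) = exponentSum T Ξ (m + 1) +
        (compoundExponent T Ξ (m + 2) - compoundExponent T Ξ (m + 1)) :=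
      Finset.sum_Icc_succ_top (by omega) _
    rw [hsum, ih]
    induction h : compoundExponent T Ξ (m + 1) with
    | bot => rw [compoundExponent_succ_eq_bot hT m.succ_pos h, EReal.bot_add]
    | top => exact absurd h (htop _).ne
    | coe a => rw [add_comm, EReal.sub_add_cancel]

theorem uniformExponent_succ (hT : IsTimeSet T) (htop : ∀ m, compoundExponent T Ξ m < ⊤) (m : ℕ) :
    uniformExponent T Ξ (m + 1) = exponentSum T Ξ (m + 1) - exponentSum T Ξ m := by
  rcases m with _ | m
  · simp [exponentSum, uniformExponent]
  · rw [exponentSum_succ hT htop, exponentSum_succ hT htop]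
    rfl

theorem exponentSum_lt_top (hT : IsTimeSet T) (htop : ∀ m, compoundExponent T Ξ m < ⊤) (m : ℕ) :
    exponentSum T Ξ m < ⊤ := by
  rcases m with _ | m
  · simp [exponentSum_zero]
  · rw [exponentSum_succ hT htop]
    exact htop _

theorem exponentSum_succ_neg (hT : IsTimeSet T) (htop : ∀ m, compoundExponent T Ξ m < ⊤) {m : ℕ}
    (h : exponentSum T Ξ m < 0) : exponentSum T Ξ (m + 1) < 0 := by
  rcases m with _ | m
  · simp [exponentSum_zero] at h
  · rw [exponentSum_succ hT htop] at h ⊢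
    refine (compoundExponent_succ_le hT Ξ m.succ_pos).trans_lt ?_
    exact EReal.mul_neg_iff.2 (Or.inl ⟨EReal.coe_pos.2 (by positivity), h⟩)

theorem exponentSum_neg_of_le (hT : IsTimeSet T) (htop : ∀ m, compoundExponent T Ξ m < ⊤)
    {m n : ℕ} (h : exponentSum T Ξ m < 0) (hmn : m ≤ n) : exponentSum T Ξ n < 0 := by
  induction n, hmn using Nat.le_induction with
  | base => exact h
  | succ n _ ih => exact exponentSum_succ_neg hT htop ih

theorem kaplanYorkeDim_eq (hT : IsTimeSet T) (htop : ∀ m, compoundExponent T Ξ m < ⊤) {m : ℕ}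
    (hm : IsGreatest {m : ℕ | 0 ≤ exponentSum T Ξ m} m) :
    kaplanYorkeDim T Ξ = (m : EReal) + exponentSum T Ξ m /
      ((exponentSum T Ξ (m + 1) - exponentSum T Ξ m).abs : EReal) := by
  have h : ∃ m : ℕ, IsGreatest {m : ℕ | 0 ≤ exponentSum T Ξ m} m := ⟨m, hm⟩
  rw [kaplanYorkeDim, dif_pos h, h.choose_spec.unique hm, uniformExponent_succ hT htop]

theorem coe_div_abs_sub {a b : ℝ} (ha : 0 ≤ a) (hb : b < 0) :
    (a : EReal) / (((b : EReal) - a).abs : EReal) = ((a / (a - b) : ℝ) : EReal) := by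
  rw [← EReal.coe_sub, EReal.abs_def, EReal.coe_ennreal_ofReal, max_eq_left (abs_nonneg _),
    abs_sub_comm, abs_of_pos (by linarith), EReal.coe_div]

theorem coe_div_abs_bot_sub (a : ℝ) : (a : EReal) / (((⊥ : EReal) - a).abs : EReal) = 0 := by
  simp

/-- For real `b` the quotient is the zero `a / (a - b)` of the decreasing function `γ ↦ (1 - γ) a +
γ b`, so it lies to the left of any `γ` where this function is nonpositive. For `b = -∞` the
quotient is `0`. -/
theorem coe_div_abs_sub_le {a y γ : ℝ} {b : EReal} (ha : 0 ≤ a) (hb : b < 0) (hby : b ≤ y)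
    (hγ : 0 ≤ γ) (h : (1 - γ) * a + γ * y ≤ 0) :
    (a : EReal) / ((b - a).abs : EReal) ≤ (γ : EReal) := by
  induction b with
  | bot => rw [coe_div_abs_bot_sub]; exact_mod_cast hγ
  | top => simp at hb
  | coe b =>
    have hb' : b < 0 := by exact_mod_cast hb
    have hby' : b ≤ y := by exact_mod_cast hby
    rw [coe_div_abs_sub ha hb', EReal.coe_le_coe_iff, div_le_iff₀ (by linarith)]
    nlinarith [mul_le_mul_of_nonneg_left hby' hγ]

/-- When the sums are finite, the Kaplan–Yorke dimension is the zero of their piecewise linear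
interpolation. The hypotheses make the interpolation negative at `m + γ` by strict bounds with real
`x`, `y`, a form that is stable in `ω`. -/
theorem kaplanYorkeDim_le (hT : IsTimeSet T) (htop : ∀ m, compoundExponent T Ξ m < ⊤) {m : ℕ}
    {γ x y : ℝ} (hγ0 : 0 < γ) (hγ1 : γ < 1) (hx : exponentSum T Ξ m < (x : EReal))
    (hy : exponentSum T Ξ (m + 1) < (y : EReal)) (h : (1 - γ) * x + γ * y < 0) :
    kaplanYorkeDim T Ξ ≤ ((m + γ : ℝ) : EReal) := by
  have hneg : exponentSum T Ξ (m + 1) < 0 := by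
    by_contra! h0
    have hy0 : 0 < y := by exact_mod_cast h0.trans_lt hy
    have h0' : 0 ≤ exponentSum T Ξ m := by
      by_contra! h1
      exact h0.not_gt (exponentSum_succ_neg hT htop h1)
    have hx0 : 0 < x := by exact_mod_cast h0'.trans_lt hx
    nlinarith [mul_pos hγ0 hy0, mul_pos (sub_pos.2 hγ1) hx0]
  have hbdd : ∀ k ∈ {m : ℕ | 0 ≤ exponentSum T Ξ m}, k ≤ m := by
    intro k hk
    by_contra! hmk
    exact (exponentSum_neg_of_le hT htop hneg hmk).not_ge hk
  obtain ⟨k, hk⟩ : ∃ k, IsGreatest {m : ℕ | 0 ≤ exponentSum T Ξ m} k := by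
    have hne : {m : ℕ | 0 ≤ exponentSum T Ξ m}.Nonempty := ⟨0, exponentSum_zero.ge⟩
    exact ⟨_, Nat.sSup_mem hne ⟨m, hbdd⟩, fun n hn => le_csSup ⟨m, hbdd⟩ hn⟩
  have hk1 : exponentSum T Ξ (k + 1) < 0 := by
    by_contra! h1
    exact absurd (hk.2 h1) (by omega)
  rw [kaplanYorkeDim_eq hT htop hk]
  have hk0 : 0 ≤ exponentSum T Ξ k := hk.1
  lift exponentSum T Ξ k to ℝ using
    ⟨(exponentSum_lt_top hT htop k).ne, (EReal.bot_lt_zero.trans_le hk0).ne'⟩ with a ha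
  have ha0 : 0 ≤ a := by exact_mod_cast hk0
  rcases (hbdd k hk.1).lt_or_eq with hkm | rfl
  -- For `k < m` the crude bound `1` on the fraction is enough, since `k + 1 ≤ m`.
  · have hfrac := coe_div_abs_sub_le (y := 0) (γ := 1) ha0 hk1 hk1.le zero_le_one (by simp)
    refine (add_le_add le_rfl hfrac).trans ?_
    have : ((k + 1 : ℕ) : ℝ) ≤ m := by exact_mod_cast hkm
    push_cast at this
    have h2 : ((k + 1 : ℝ) : EReal) ≤ ((m + γ : ℝ) : EReal) := EReal.coe_le_coe (by linarith)
    simpa using h2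
  · have hax : a < x := by rw [← ha] at hx; exact_mod_cast hx
    have hfrac := coe_div_abs_sub_le ha0 hk1 hy.le hγ0.le
      (by nlinarith [mul_pos (sub_pos.2 hγ1) (sub_pos.2 hax)])
    refine (add_le_add le_rfl hfrac).trans ?_
    simp

/-- The converse of `kaplanYorkeDim_le`: a point `m + γ` is taken strictly between the dimension and
`z`, with `γ < 1`. -/
theorem exists_of_kaplanYorkeDim_lt (hT : IsTimeSet T) (htop : ∀ m, compoundExponent T Ξ m < ⊤)
    {z : ℝ} (hz : kaplanYorkeDim T Ξ < (z : EReal)) :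
    ∃ (m : ℕ) (γ x y : ℝ), 0 < γ ∧ γ < 1 ∧ m + γ < z ∧ exponentSum T Ξ m < (x : EReal) ∧
      exponentSum T Ξ (m + 1) < (y : EReal) ∧ (1 - γ) * x + γ * y < 0 := by
  obtain ⟨m, hm⟩ : ∃ m, IsGreatest {m : ℕ | 0 ≤ exponentSum T Ξ m} m := by
    by_contra h
    rw [kaplanYorkeDim, dif_neg h] at hz
    exact not_top_lt hz
  have hm1 : exponentSum T Ξ (m + 1) < 0 := by
    by_contra! h1
    exact absurd (hm.2 h1) (by omega)
  rw [kaplanYorkeDim_eq hT htop hm] at hz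
  refine ⟨m, ?_⟩
  have hm0 : 0 ≤ exponentSum T Ξ m := hm.1
  lift exponentSum T Ξ m to ℝ using
    ⟨(exponentSum_lt_top hT htop m).ne, (EReal.bot_lt_zero.trans_le hm0).ne'⟩ with a ha
  have ha0 : 0 ≤ a := by exact_mod_cast hm0
  clear hm
  generalize exponentSum T Ξ (m + 1) = b at hm1 hz ⊢
  induction b with
  | top => simp at hm1
  | bot =>
    rw [coe_div_abs_bot_sub, add_zero] at hz
    have hz' : (m : ℝ) < z := by exact_mod_cast hz
    obtain ⟨γ, hγ0, hγ⟩ := exists_between (lt_min one_pos (sub_pos.2 hz'))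
    have hγ1 := hγ.trans_le (min_le_left _ _)
    have hγ2 := hγ.trans_le (min_le_right _ _)
    -- As the next sum is `-∞`, any `y` is allowed; this one gives `(1 - γ) x + γ y = -1`.
    refine ⟨γ, a + 1, -((1 - γ) * (a + 1) + 1) / γ, hγ0, hγ1, by linarith, ?_,
      EReal.bot_lt_coe _, ?_⟩
    · exact_mod_cast lt_add_one a
    · rw [mul_div_cancel₀ _ hγ0.ne']
      linarith
  | coe b =>
    have hb : b < 0 := by exact_mod_cast hm1
    rw [coe_div_abs_sub ha0 hb] at hz
    have hz' : m + a / (a - b) < z := by exact_mod_cast hz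
    have hab : 0 < a - b := by linarith
    have hφ1 : a / (a - b) < 1 := (div_lt_one hab).2 (by linarith)
    obtain ⟨γ, hγφ, hγ⟩ := exists_between (lt_min hφ1 (lt_sub_iff_add_lt'.2 hz'))
    have hγ1 := hγ.trans_le (min_le_left _ _)
    have hγ2 := hγ.trans_le (min_le_right _ _)
    have hγ0 : 0 < γ := (div_nonneg ha0 hab.le).trans_lt hγφ
    have hneg : (1 - γ) * a + γ * b < 0 := by
      have := (div_lt_iff₀ hab).1 hγφ
      linarith
    -- Raising both values by `δ` raises the weighted mean by `δ`, half of its distance to `0`.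
    set δ := -((1 - γ) * a + γ * b) / 2 with hδ
    refine ⟨γ, a + δ, b + δ, hγ0, hγ1, by linarith, ?_, ?_, ?_⟩
    · rw [EReal.coe_lt_coe_iff]; linarith
    · rw [EReal.coe_lt_coe_iff]; linarith
    · linarith

/-- Upper semicontinuity of the Kaplan–Yorke dimension follows from that of the exponents of the
compound cocycles. -/
theorem limsup_kaplanYorkeDim_le {Ω : Type*} [TopologicalSpace Ω] (hT : IsTimeSet T)
    {Ξ : Ω → ℝ → Q → H →L[𝕜] H} (htop : ∀ ω m, compoundExponent T (Ξ ω) m < ⊤) (ω₀ : Ω)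
    (husc : ∀ m, limsup (fun ω => compoundExponent T (Ξ ω) m) (𝓝 ω₀) ≤
      compoundExponent T (Ξ ω₀) m) :
    limsup (fun ω => kaplanYorkeDim T (Ξ ω)) (𝓝 ω₀) ≤ kaplanYorkeDim T (Ξ ω₀) := by
  have hev : ∀ m (x : ℝ), exponentSum T (Ξ ω₀) m < (x : EReal) →
      ∀ᶠ ω in 𝓝 ω₀, exponentSum T (Ξ ω) m < (x : EReal) := by
    intro m x hx
    rcases m with _ | m
    · simp only [exponentSum_zero] at hx ⊢
      exact Eventually.of_forall fun _ => hx
    · simp only [exponentSum_succ hT (htop _)] at hx ⊢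
      exact eventually_lt_of_limsup_lt ((husc _).trans_lt hx)
  refine EReal.le_of_forall_lt_iff_le.1 fun z hz => ?_
  obtain ⟨m, γ, x, y, hγ0, hγ1, hmz, hx, hy, h⟩ := exists_of_kaplanYorkeDim_lt hT (htop ω₀) hz
  refine limsup_le_of_le (by isBoundedDefault) ?_
  filter_upwards [hev m x hx, hev (m + 1) y hy] with ω hωx hωy
  exact (kaplanYorkeDim_le hT (htop ω) hγ0 hγ1 hωx hωy h).trans (EReal.coe_le_coe hmz.le)

end KaplanYorke

end UniformLyapunov

/-! ### The semicontinuity theorem -/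

open UniformLyapunov in
theorem mainTheorem9
    {𝕜 Ω Q E H : Type*} [RCLike 𝕜]
    [MetricSpace Ω] [CompleteSpace Ω]
    [MetricSpace Q] [CompleteSpace Q]
    [NormedAddCommGroup E] [NormedSpace 𝕜 E] [CompleteSpace E]
    [NormedAddCommGroup H] [InnerProductSpace 𝕜 H] [CompleteSpace H]
    (T : Set ℝ) (hT : IsTimeSet T)
    (θ : Ω → ℝ → Q → Q) (hθ : ∀ ω, IsDynamicalSystem T (θ ω))
    (A : Ω → Set Q) (hA : ∀ ω, IsAttractor T (θ ω) (A ω))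
    (B₀ : Set Q) (hB₀ : ∀ ω, A ω ⊆ B₀)
    (ω₀ : Ω) :
    -- subadditive families
    (∀ f : Ω → ℝ → Q → EReal,
      (∀ ω, IsProperSubadditive T (θ ω) (f ω)) →
      FamilyEventuallyConverges T f ω₀ B₀ →
        (∀ ω, Tendsto (meanGrowth (f ω)) (timesAtTop T) (𝓝 (growthExponent T (f ω)))) ∧
        limsup (fun ω => growthExponent T (f ω)) (𝓝 ω₀) ≤ growthExponent T (f ω₀)) ∧
    -- cocycles in a Banach space
    (∀ Ξ : Ω → ℝ → Q → E →L[𝕜] E,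
      (∀ ω, IsUniformlyContinuousCocycle T (θ ω) (Ξ ω)) →
      CocycleEventuallyConverges T Ξ ω₀ B₀ →
        (∀ ω, Tendsto (meanLogNorm (Ξ ω)) (timesAtTop T) (𝓝 (largestExponent T (Ξ ω)))) ∧
        limsup (fun ω => largestExponent T (Ξ ω)) (𝓝 ω₀) ≤ largestExponent T (Ξ ω₀)) ∧
    -- cocycles in a Hilbert space
    (∀ Ξ : Ω → ℝ → Q → H →L[𝕜] H,
      (∀ ω, IsUniformlyContinuousCocycle T (θ ω) (Ξ ω)) →
      CocycleEventuallyConverges T Ξ ω₀ B₀ →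
        (∀ d : ℝ, 0 ≤ d →
          (∀ ω, Tendsto (meanSingularFunction d (Ξ ω)) (timesAtTop T)
            (𝓝 (averagedSingularFunction T d (Ξ ω)))) ∧
          limsup (fun ω => averagedSingularFunction T d (Ξ ω)) (𝓝 ω₀) ≤
            averagedSingularFunction T d (Ξ ω₀)) ∧
        (∀ m : ℕ, 1 ≤ m → ∀ ω, Tendsto (meanLogCompoundNorm m (Ξ ω)) (timesAtTop T)
          (𝓝 (compoundExponent T (Ξ ω) m))) ∧
        limsup (fun ω => kaplanYorkeDim T (Ξ ω)) (𝓝 ω₀) ≤ kaplanYorkeDim T (Ξ ω₀) ∧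
        limsup (fun ω => lyapunovDim T (Ξ ω)) (𝓝 ω₀) ≤ lyapunovDim T (Ξ ω₀)) := by
  refine ⟨fun f hf hconv => ⟨fun ω => (hf ω).tendsto_meanGrowth hT,
    limsup_growthExponent_le_of_eventuallyConverges hT hA hB₀ ω₀ hf hconv⟩,
    fun Ξ hΞ hconv => ?_, fun Ξ hΞ hconv => ?_⟩
  · have hlargest : ∀ ω, largestExponent T (Ξ ω) =
        growthExponent T (logFamily (fun L => ‖L‖) (Ξ ω)) := fun ω => by
      rw [largestExponent, meanLogNorm_eq, growthExponent]
    simp only [hlargest, meanLogNorm_eq]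
    exact ⟨fun ω => (isSubmultiplicativeFunctional_norm.isProperSubadditive
      (hΞ ω)).tendsto_meanGrowth hT,
      isSubmultiplicativeFunctional_norm.limsup_growthExponent_le hT hA hB₀ ω₀ hΞ hconv⟩
  have hΦ : ∀ d : ℝ, 0 ≤ d →
      IsSubmultiplicativeFunctional (𝕜 := 𝕜) (E := H) (singularFunction d) :=
    fun d hd => isSubmultiplicativeFunctional_singularFunction hd
  have hsub : ∀ d : ℝ, 0 ≤ d → ∀ ω,
      IsProperSubadditive T (θ ω) (logFamily (singularFunction d) (Ξ ω)) :=
    fun d hd ω => (hΦ d hd).isProperSubadditive (hΞ ω)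
  have husc : ∀ d : ℝ, 0 ≤ d →
      limsup (fun ω => growthExponent T (logFamily (singularFunction d) (Ξ ω))) (𝓝 ω₀) ≤
        growthExponent T (logFamily (singularFunction d) (Ξ ω₀)) :=
    fun d hd => (hΦ d hd).limsup_growthExponent_le hT hA hB₀ ω₀ hΞ hconv
  have havg : ∀ d : ℝ, 0 ≤ d →
      limsup (fun ω => averagedSingularFunction T d (Ξ ω)) (𝓝 ω₀) ≤
        averagedSingularFunction T d (Ξ ω₀) := by
    intro d hd
    simp only [averagedSingularFunction_eq, ← exp_limsup]
    exact EReal.exp_monotone (husc d hd)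
  refine ⟨fun d hd => ⟨fun ω => ?_, havg d hd⟩, fun m _ ω => ?_, ?_,
    limsup_lyapunovDim_le ω₀ havg⟩
  · rw [averagedSingularFunction_eq, funext (meanSingularFunction_eq d (Ξ ω))]
    exact (ENNReal.continuous_exp.tendsto _).comp ((hsub d hd ω).tendsto_meanGrowth hT)
  · rw [compoundExponent_eq, meanLogCompoundNorm_eq]
    exact (hsub m m.cast_nonneg ω).tendsto_meanGrowth hT
  · refine limsup_kaplanYorkeDim_le hT (fun ω m => ?_) ω₀ fun m => ?_
    · rw [compoundExponent_eq]
      exact (hsub m m.cast_nonneg ω).growthExponent_lt_top hT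
    · simp only [compoundExponent_eq]
      exact husc m m.cast_nonneg
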